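/- **Theorem 5.4.** Let $m>1$ and let $P\subset\mathbb R^{2m}$ be a $2m$-dimensional convex polytope with at least $2m+3$ vertices which is neighbourly, i.e. the convex hull of any $m$ vertices of $P$ is a proper face of $P$. Write $\mathcal V(Q)$ for the vertex set of a polytope $Q$ and $[\cdot]$ for convex hull. For a neighbourly $2m$-polytope $Q$, a $(2k-1)$-dimensional face $U$ of $Q$ is called *universal* if $[S,U]$ is a face of $Q$ for every $S\subseteq\mathcal V(Q)$ with $|S|\le m-k$; $\mathcal U_{2k-1}(Q)$ denotes the set of these faces. Let $x_1,\dots,x_m,y_1,\dots,y_m$ be distinct vertices of $P$, put $\Phi_0=\emptyset$ and $\Phi_j=[x_1,y_1,\dots,x_j,y_j]$, and assume that $\Phi_j\in\mathcal U_{2j-1}(P)$ for $j=1,\dots,m$. For $0\le j\le m$ let $\mathscr F_j$ be the set of facets of $P$ containing $\Phi_j$, let $\mathscr F_j=\emptyset$ for $j>m$, and let $\mathcal C=(\mathscr F_1\setminus\mathscr F_2)\cup(\mathscr F_3\setminus\mathscr F_4)\cup\cdots$. Let $\bar x\in\mathbb R^{2m}$ be a point that lies on the affine hull of no facet of $P$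 and such that, for every facet $F$ of $P$, the hyperplane $\operatorname{aff}F$ separates $\bar x$ from $P$ if and only if $F\in\mathcal C$. Let $P^+=[P,\bar x]$ (the polytope obtained by sewing $\bar x$ onto $P$). Let $0\le i<k<m$ be integers and let $U\in\mathcal U_{2k-1}(P)$ with $\Phi_i\subseteq U$ and $x_{i+1}\notin U$. Then $$U\in\mathcal U_{2k-1}(P^+)\iff i\text{ is even and }[U,\bar x,x_{i+1}]\in\mathcal U_{2k+1}(P^+).$$ -/

import Mathlib

namespace SewnPolytope

variable {E : Type*} [NormedAddCommGroup E] [NormedSpace ℝ E]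

/-- The dimension of (the affine hull of) a set. -/
noncomputable def affDim (A : Set E) : ℕ := Module.finrank ℝ (vectorSpan ℝ A)

/-- A convex polytope: the convex hull of a nonempty finite set of points. -/
def IsPolytope (P : Set E) : Prop :=
  ∃ s : Finset E, s.Nonempty ∧ P = convexHull ℝ (s : Set E)

/-- The vertex set of `P`. -/
abbrev vertices (P : Set E) : Set E := P.extremePoints ℝ

/-- `F` is a face of `P`: the intersection of `P` with a supporting hyperplane, or one of the
improper faces `∅`, `P`. -/
def IsFace (P F : Set E) : Prop := IsExposed ℝ P F

/-- `F` is a nonempty face of `P` of dimension `k`. -/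
def IsFaceOfDim (P : Set E) (k : ℕ) (F : Set E) : Prop :=
  F.Nonempty ∧ IsFace P F ∧ affDim F = k

/-- `F` is a facet of `P`: a face of dimension one less than `P`. -/
def IsFacet (P F : Set E) : Prop :=
  F.Nonempty ∧ IsFace P F ∧ affDim F + 1 = affDim P

/-- `P` is a neighbourly polytope: with `d = dim P`, any `⌊d / 2⌋` vertices of `P` determine
(i.e. their convex hull is) a proper face of `P`. -/
def IsNeighbourly (P : Set E) : Prop :=
  IsPolytope P ∧ ∀ S : Finset E, (S : Set E) ⊆ vertices P → S.card = affDim P / 2 →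
    IsFace P (convexHull ℝ (S : Set E)) ∧ convexHull ℝ (S : Set E) ≠ P

/-- `U` is a universal `k`-face of `P`: it is a `k`-face, and `[S, U]` is a face of `P` for every
set `S` of at most `⌊(d - k - 1) / 2⌋` vertices of `P`, where `d = dim P`. -/
def IsUniversalFace (P : Set E) (k : ℕ) (U : Set E) : Prop :=
  IsFaceOfDim P k U ∧
    ∀ S : Finset E, (S : Set E) ⊆ vertices P → S.card ≤ (affDim P - k - 1) / 2 →
      IsFace P (convexHull ℝ ((S : Set E) ∪ U))

/-- `Φ_j = [x_1, y_1, …, x_j, y_j]`; in particular `Φ_0 = ∅`. -/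
def towerFace (x y : ℕ → E) (j : ℕ) : Set E :=
  convexHull ℝ (x '' Set.Icc 1 j ∪ y '' Set.Icc 1 j)

/-- `x_1, …, x_m, y_1, …, y_m` are pairwise distinct vertices of `P` and `Φ_1, …, Φ_m` is a
universal tower in `P` (the values of `x` and `y` outside `{1, …, m}` play no role). -/
structure IsUniversalTower (P : Set E) (m : ℕ) (x y : ℕ → E) : Prop where
  x_mem : ∀ j ∈ Set.Icc 1 m, x j ∈ vertices P
  y_mem : ∀ j ∈ Set.Icc 1 m, y j ∈ vertices P
  x_injOn : Set.InjOn x (Set.Icc 1 m)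
  y_injOn : Set.InjOn y (Set.Icc 1 m)
  x_ne_y : ∀ j ∈ Set.Icc 1 m, ∀ l ∈ Set.Icc 1 m, x j ≠ y l
  universal : ∀ j ∈ Set.Icc 1 m, IsUniversalFace P (2 * j - 1) (towerFace x y j)

/-- `ℱ_j`: the facets of `P` that contain `Φ_j`, with `ℱ_j = ∅` for `j > m`. -/
def facetsThrough (P : Set E) (m : ℕ) (x y : ℕ → E) (j : ℕ) : Set (Set E) :=
  {F | j ≤ m ∧ IsFacet P F ∧ towerFace x y j ⊆ F}

/-- `𝒞(𝒯) = (ℱ_1 \ ℱ_2) ∪ (ℱ_3 \ ℱ_4) ∪ …`. -/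
def towerFacets (P : Set E) (m : ℕ) (x y : ℕ → E) : Set (Set E) :=
  ⋃ r : ℕ, facetsThrough P m x y (2 * r + 1) \ facetsThrough P m x y (2 * r + 2)

/-- The point `z`, not in `aff F`, is beyond the facet `F` of `P`: `aff F` separates `P` from
`z`. -/
def IsBeyond (P F : Set E) (z : E) : Prop :=
  z ∉ affineSpan ℝ F ∧ ∀ p ∈ P, (affineSpan ℝ F).WOppSide p z

/-- The point `z`, not in `aff F`, is beneath the facet `F` of `P`: it is not beyond `F`. -/
def IsBeneath (P F : Set E) (z : E) : Prop :=
  z ∉ affineSpan ℝ F ∧ ¬ IsBeyond P F z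

/-- The point `z` lies exactly beyond the set `C` of facets of `P`. -/
def IsExactlyBeyond (P : Set E) (C : Set (Set E)) (z : E) : Prop :=
  (∀ F ∈ C, IsBeyond P F z) ∧ ∀ F, IsFacet P F → F ∉ C → IsBeneath P F z

/-- `P⁺ = [P, z]`. -/
def sewn (P : Set E) (z : E) : Set E := convexHull ℝ (insert z P)

end SewnPolytope

/-
Homogenizing `p ↦ (p, 1)` turns the vertices of a `2m`-polytope into a vector configuration of rank
`2m + 1`. By Stiemke's theorem, linearly independent vertices `U` span a face together with any `r`
further vertices if and only if every nonzero linear dependence of the configuration has more than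
`r` positive coefficients outside `U`. In particular neighbourly polytopes have no nonzero
dependence with few positive coefficients, so small sets of vertices are independent.

The position of the sewn point `z` enters only through signs: a proper face containing `Φ_j` but
not all of `Φ_{j+1}` has a supporting functional whose value at `z` has sign `(-1)^j`. Evaluating it
on a dependence of the enlarged configuration controls the sign of the coefficient at `z`. The
theorem then compares, for `U` of `2k` vertices, the dependences with at most `m - k` positive
coefficients outside `U` with those having at most `m - k - 1` outside `U ∪ {z, x_{i+1}}`: a
dependence violating one condition has prescribed signs at `z` and `x_{i+1}`, and after elimination
its support becomes too small for the signs it carries.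
-/

namespace SewnPolytope

section Dependences

variable {α W : Type*} [AddCommGroup W] [Module ℝ W] {h : α → W} {X Y A : Finset α}
  {c : α →₀ ℝ}

/-- The linear dependences among the vectors `h v`, `v ∈ X`. -/
noncomputable def dependences (h : α → W) (X : Finset α) : Submodule ℝ (α →₀ ℝ) :=
  Finsupp.supported ℝ ℝ (X : Set α) ⊓ LinearMap.ker (Finsupp.linearCombination ℝ h)

/-- The positive part of the signed support of `c`. -/
noncomputable def positives (c : α →₀ ℝ) : Finset α := {v ∈ c.support | 0 < c v}

/-- `A` is the set of indices in `X` whose vectors lie in some face of the cone spanned by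
`h '' X`; equivalently, `X \ A` is the support of a nonnegative covector of the configuration. -/
def IsConeFace (h : α → W) (X A : Finset α) : Prop :=
  ∃ φ : W →ₗ[ℝ] ℝ, (∀ v ∈ A, φ (h v) = 0) ∧ ∀ v ∈ X, v ∉ A → 0 < φ (h v)

lemma mem_dependences :
    c ∈ dependences h X ↔ c.support ⊆ X ∧ Finsupp.linearCombination ℝ h c = 0 := by
  simp only [dependences, Submodule.mem_inf, Finsupp.mem_supported, Finset.coe_subset,
    LinearMap.mem_ker]

lemma dependences_mono (hXY : X ⊆ Y) : dependences h X ≤ dependences h Y :=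
  inf_le_inf_right _ (Finsupp.supported_mono (Finset.coe_subset.2 hXY))

lemma mem_dependences_of_support_subset (hc : c ∈ dependences h X) (hY : c.support ⊆ Y) :
    c ∈ dependences h Y :=
  mem_dependences.2 ⟨hY, (mem_dependences.1 hc).2⟩

lemma linearIndepOn_iff_dependences_eq_bot :
    LinearIndepOn ℝ h X ↔ dependences h X = ⊥ :=
  linearIndepOn_iff_disjoint.trans disjoint_iff

@[simp]
lemma mem_positives {v : α} : v ∈ positives c ↔ 0 < c v := by
  simp +contextual [positives, ne_of_gt]

lemma positives_subset_support : positives c ⊆ c.support :=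
  Finset.filter_subset _ _

lemma sum_mul_apply_eq_zero (hc : c ∈ dependences h X) (φ : W →ₗ[ℝ] ℝ) :
    ∑ v ∈ X, c v * φ (h v) = 0 := by
  obtain ⟨hcX, hc0⟩ := mem_dependences.1 hc
  rw [Finsupp.linearCombination_apply, Finsupp.sum_of_support_subset _ hcX _ (by simp)] at hc0
  simpa using congrArg φ hc0

lemma mul_apply_eq_zero_of_nonpos (hc : c ∈ dependences h X) (φ : W →ₗ[ℝ] ℝ)
    (hle : ∀ v ∈ X, c v * φ (h v) ≤ 0) : ∀ v ∈ X, c v * φ (h v) = 0 :=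
  (Finset.sum_eq_zero_iff_of_nonpos hle).1 (sum_mul_apply_eq_zero hc φ)

lemma IsConeFace.support_subset (hA : IsConeFace h X A) (hc : c ∈ dependences h X)
    (hpos : positives c ⊆ A) : c.support ⊆ A := by
  obtain ⟨φ, hzero, hφ⟩ := hA
  have hle (v) (hv : v ∈ X) : c v * φ (h v) ≤ 0 := by
    by_cases hvA : v ∈ A
    · simp [hzero v hvA]
    · exact mul_nonpos_of_nonpos_of_nonneg (not_lt.1 fun h0 ↦ hvA (hpos (mem_positives.2 h0)))
        (hφ v hv hvA).le
  intro v hv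
  have hvX := (mem_dependences.1 hc).1 hv
  by_contra hvA
  exact (mul_eq_zero.1 (mul_apply_eq_zero_of_nonpos hc φ hle v hvX)).elim
    (Finsupp.mem_support_iff.1 hv) (hφ v hvX hvA).ne'

lemma apply_eq_zero_of_forall_lt {V : Type*} [AddCommGroup V] [Module ℝ V] {L : Submodule ℝ V}
    {f : V →ₗ[ℝ] ℝ} {b : ℝ} (hf : ∀ p ∈ L, b < f p) : ∀ p ∈ L, f p = 0 := by
  intro p hp
  by_contra hne
  have := hf _ (L.smul_mem (b / f p) hp)
  simp [hne] at this

/-- Stiemke's theorem of the alternative. -/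
lemma exists_pos_forall_sum_mul_eq_zero {ι : Type*} [Fintype ι] {L : Submodule ℝ (ι → ℝ)}
    (hL : ∀ p ∈ L, 0 ≤ p → p = 0) :
    ∃ g : ι → ℝ, (∀ i, 0 < g i) ∧ ∀ p ∈ L, ∑ i, p i * g i = 0 := by
  classical
  have hdisj : Disjoint (stdSimplex ℝ ι) (L : Set (ι → ℝ)) :=
    Set.disjoint_left.2 fun p hp hpL ↦ by simpa [hL p hpL hp.1] using hp.2
  obtain ⟨f, a, b, hf, hab, hfL⟩ := geometric_hahn_banach_compact_closed (convex_stdSimplex ℝ ι)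
    (isCompact_stdSimplex ℝ ι) L.convex L.closed_of_finiteDimensional hdisj
  refine ⟨fun i ↦ -f (if i = · then 1 else 0), fun i ↦ ?_, fun p hp ↦ ?_⟩
  · have hb : b < 0 := by simpa using hfL 0 L.zero_mem
    linarith [hf _ (ite_eq_mem_stdSimplex ℝ i)]
  · have hsum := LinearMap.pi_apply_eq_sum_univ f.toLinearMap p
    rw [apply_eq_zero_of_forall_lt hfL p hp] at hsum
    simpa using hsum.symm

lemma exists_comp_eq_of_ker_le_ker {V : Type*} [AddCommGroup V] [Module ℝ V] {f : V →ₗ[ℝ] W}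
    {ψ : V →ₗ[ℝ] ℝ} (hle : LinearMap.ker f ≤ LinearMap.ker ψ) : ∃ φ : W →ₗ[ℝ] ℝ, φ ∘ₗ f = ψ :=
  (LinearMap.range_dualMap_eq_dualAnnihilator_ker f).ge <|
    (Submodule.mem_dualAnnihilator _).2 hle

lemma exists_dual_forall_apply_eq {g : α → ℝ}
    (hg : ∀ c ∈ dependences h X, ∑ v ∈ X, c v * g v = 0) :
    ∃ φ : W →ₗ[ℝ] ℝ, ∀ v ∈ X, φ (h v) = g v := by
  let f := (Finsupp.linearCombination ℝ h).domRestrict (Finsupp.supported ℝ ℝ (X : Set α))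
  let ψ := (Finsupp.linearCombination ℝ g).domRestrict (Finsupp.supported ℝ ℝ (X : Set α))
  obtain ⟨φ, hφ⟩ := exists_comp_eq_of_ker_le_ker (V := Finsupp.supported ℝ ℝ (X : Set α))
    (f := f) (ψ := ψ) <| by
      rintro ⟨c, hc⟩ hker
      have hsum := hg c ⟨hc, hker⟩
      rwa [← Finsupp.sum_of_support_subset (f := c) (Finset.coe_subset.1 hc) (fun v a ↦ a * g v)
        (by simp)] at hsum
  refine ⟨φ, fun v hv ↦ ?_⟩
  simpa [f, ψ] using LinearMap.congr_fun hφ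
    ⟨Finsupp.single v 1, Finsupp.single_mem_supported ℝ 1 (Finset.mem_coe.2 hv)⟩

lemma isConeFace_iff (hAX : A ⊆ X) :
    IsConeFace h X A ↔ ∀ c ∈ dependences h X, positives c ⊆ A → c.support ⊆ A := by
  classical
  refine ⟨fun hA c ↦ hA.support_subset, fun hA ↦ ?_⟩
  let restrict : (α →₀ ℝ) →ₗ[ℝ] (↥(X \ A) → ℝ) := LinearMap.pi fun v ↦ Finsupp.lapply v.1
  obtain ⟨g, hgpos, hg⟩ := exists_pos_forall_sum_mul_eq_zero
    (L := (dependences h X).map restrict) <| by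
      rintro _ ⟨c, hc, rfl⟩ hnonneg
      have hsupp : (-c).support ⊆ A := hA _ (neg_mem hc) fun v hv ↦ by
        have hneg : c v < 0 := by simpa using hv
        by_contra hvA
        have hvX := (mem_dependences.1 hc).1 (Finsupp.mem_support_iff.2 hneg.ne)
        exact hneg.not_ge (hnonneg ⟨v, Finset.mem_sdiff.2 ⟨hvX, hvA⟩⟩)
      rw [Finsupp.support_neg] at hsupp
      ext ⟨v, hv⟩
      exact Finsupp.notMem_support_iff.1 fun h0 ↦ (Finset.mem_sdiff.1 hv).2 (hsupp h0)
  let g' : α → ℝ := Function.extend Subtype.val g 0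
  have hg'A (v) (hv : v ∈ A) : g' v = 0 :=
    Function.extend_apply' _ _ _ (by rintro ⟨⟨_, hu⟩, rfl⟩; exact (Finset.mem_sdiff.1 hu).2 hv)
  have hg'X (v : ↥(X \ A)) : g' v = g v := Subtype.val_injective.extend_apply g 0 v
  obtain ⟨φ, hφ⟩ := exists_dual_forall_apply_eq (h := h) (X := X) (g := g') fun c hc ↦ by
    rw [← Finset.sum_sdiff hAX, Finset.sum_eq_zero (s := A) fun v hv ↦ by rw [hg'A v hv, mul_zero],
      add_zero, ← Finset.sum_coe_sort]
    simpa [hg'X, restrict] using hg _ ⟨c, hc, rfl⟩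
  refine ⟨φ, fun v hv ↦ (hφ v (hAX hv)).trans (hg'A v hv), fun v hvX hvA ↦ ?_⟩
  rw [hφ v hvX, hg'X ⟨v, Finset.mem_sdiff.2 ⟨hvX, hvA⟩⟩]
  exact hgpos _

end Dependences

section PositivesExceed

variable {α W : Type*} [AddCommGroup W] [Module ℝ W] {h : α → W} [DecidableEq α]
  {X Y U T : Finset α} {c : α →₀ ℝ} {r : ℕ}

/-- The combinatorial content of universality: `U` spans a face of the cone over `h '' X` together
with any `r` further points. -/
def IsUniversalIn (h : α → W) (X U : Finset α) (r : ℕ) : Prop :=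
  ∀ S ⊆ X, S.card ≤ r → IsConeFace h X (S ∪ U)

/-- Every nonzero dependence has more than `r` positive coefficients outside `U`. By
`positivesExceed_iff`, this is the dual description of a simplicial universal face. -/
def PositivesExceed (h : α → W) (X U : Finset α) (r : ℕ) : Prop :=
  ∀ c ∈ dependences h X, c ≠ 0 → r < (positives c \ U).card

lemma card_positives_sdiff_add_card_positives_neg_sdiff (c : α →₀ ℝ) (U : Finset α) :
    (positives c \ U).card + (positives (-c) \ U).card = (c.support \ U).card := by
  rw [← Finset.card_union_of_disjoint]
  · congr 1
    ext v
    simp only [Finset.mem_union, Finset.mem_sdiff, mem_positives, Finsupp.neg_apply,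
      Left.neg_pos_iff, Finsupp.mem_support_iff, ← or_and_right, ne_iff_lt_or_gt, or_comm]
  · refine Finset.disjoint_left.2 fun v hv hv' ↦ ?_
    simp only [Finset.mem_sdiff, mem_positives, Finsupp.neg_apply, Left.neg_pos_iff] at hv hv'
    exact lt_asymm hv.1 hv'.1

namespace PositivesExceed

lemma mono (hU : PositivesExceed h X U r) (hTU : T ⊆ U) : PositivesExceed h X T r :=
  fun c hc hne ↦ (hU c hc hne).trans_le (Finset.card_le_card (Finset.sdiff_subset_sdiff le_rfl hTU))

lemma lt_card_support_sdiff (hU : PositivesExceed h X U r) (hc : c ∈ dependences h X)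
    (hne : c ≠ 0) : 2 * r + 1 < (c.support \ U).card := by
  rw [← card_positives_sdiff_add_card_positives_neg_sdiff]
  have hpos := hU c hc hne
  have hneg := hU (-c) (neg_mem hc) (neg_ne_zero.2 hne)
  omega

lemma linearIndepOn (hU : PositivesExceed h X U r) (hYX : Y ⊆ X)
    (hcard : (Y \ U).card ≤ 2 * r + 1) : LinearIndepOn ℝ h (Y : Set α) := by
  refine linearIndepOn_iff_dependences_eq_bot.2 ((Submodule.eq_bot_iff _).2 fun c hc ↦ ?_)
  by_contra hne
  exact (hU.lt_card_support_sdiff (dependences_mono hYX hc) hne).not_ge <|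
    (Finset.card_le_card (Finset.sdiff_subset_sdiff (mem_dependences.1 hc).1 le_rfl)).trans hcard

lemma pos_of_card_sdiff_insert_lt (hU : PositivesExceed h X U r) (hc : c ∈ dependences h X)
    (hne : c ≠ 0) {a b : α} (hcard : (positives c \ insert a (insert b U)).card < r) :
    0 < c a := by
  by_contra ha
  have hsub : positives c \ U ⊆ insert b (positives c \ insert a (insert b U)) := by
    intro v hv
    have hva : v ≠ a := by
      rintro rfl
      exact ha (mem_positives.1 (Finset.mem_sdiff.1 hv).1)
    grind
  have hle := (Finset.card_le_card hsub).trans (Finset.card_insert_le _ _)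
  have hlt := hU c hc hne
  omega

lemma nonpos_of_card_sdiff_le (hU : PositivesExceed h X U r) (hTU : T ⊆ U)
    (hc : c ∈ dependences h X) (hne : c ≠ 0) (hcard : (positives c \ T).card ≤ r + 1) {a : α}
    (haU : a ∈ U) (haT : a ∉ T) : c a ≤ 0 := by
  by_contra! ha
  have hssub : positives c \ U ⊂ positives c \ T :=
    Finset.ssubset_iff_of_subset (Finset.sdiff_subset_sdiff le_rfl hTU) |>.2
      ⟨a, by simp [ha, haT], by simp [haU]⟩
  have hlt := hU c hc hne
  have hlt' := Finset.card_lt_card hssub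
  omega

end PositivesExceed

lemma positivesExceed_iff (hUX : U ⊆ X) :
    PositivesExceed h X U r ↔ LinearIndepOn ℝ h (U : Set α) ∧ IsUniversalIn h X U r := by
  refine ⟨fun hU ↦ ⟨hU.linearIndepOn hUX (by simp), fun S hS hSr ↦ ?_⟩, ?_⟩
  · refine (isConeFace_iff (Finset.union_subset hS hUX)).2 fun c hc hpos ↦ ?_
    rcases eq_or_ne c 0 with rfl | hne
    · simp
    have hsub : positives c \ U ⊆ S := sdiff_le_iff.2 (by rwa [sup_comm])
    exact absurd ((Finset.card_le_card hsub).trans hSr) (hU c hc hne).not_ge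
  · rintro ⟨hind, huniv⟩ c hc hne
    by_contra! hle
    have hneg : positives (-c) ⊆ U := by
      intro v hv
      have hcv : c v < 0 := by simpa using hv
      have hv' := (huniv _ (Finset.sdiff_subset.trans <|
        positives_subset_support.trans (mem_dependences.1 hc).1) hle).support_subset hc
          (sdiff_le_iff'.1 le_rfl) (Finsupp.mem_support_iff.2 hcv.ne)
      simpa [hcv.not_gt] using hv'
    have hsupp := (huniv ∅ (Finset.empty_subset _) (Nat.zero_le _)).support_subset (neg_mem hc)
      (by simpa using hneg)
    rw [Finset.empty_union] at hsupp
    have hbot := mem_dependences_of_support_subset (neg_mem hc) hsupp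
    rw [linearIndepOn_iff_dependences_eq_bot.1 hind] at hbot
    exact hne (neg_eq_zero.1 hbot)

/-- If a dependence has at most `r` positive coefficients and a negative one, the indices of the
former extend to `r` indices omitting that of the latter, and these do not form a face. -/
lemma positivesExceed_empty_of_isConeFace (hcard : r < X.card)
    (hface : ∀ S ⊆ X, S.card = r → IsConeFace h X S) : PositivesExceed h X ∅ r := by
  have hnonneg (c) (hc : c ∈ dependences h X) (hle : (positives c).card ≤ r) (v) : 0 ≤ c v := by
    by_contra! hv
    have hvX := (mem_dependences.1 hc).1 (Finsupp.mem_support_iff.2 hv.ne)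
    obtain ⟨S, hposS, hSX, hS⟩ := Finset.exists_subsuperset_card_eq (t := X.erase v)
      (fun u hu ↦ Finset.mem_erase.2 ⟨by rintro rfl; exact hv.not_gt (mem_positives.1 hu),
        (mem_dependences.1 hc).1 (positives_subset_support hu)⟩) hle
      (by rw [Finset.card_erase_of_mem hvX]; omega)
    have hvS := (hface S (hSX.trans (Finset.erase_subset _ _)) hS).support_subset hc hposS
      (Finsupp.mem_support_iff.2 hv.ne)
    exact Finset.notMem_erase v X (hSX hvS)
  intro c hc hne
  rw [Finset.sdiff_empty]
  by_contra! hle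
  have hneg : positives (-c) = ∅ := by
    ext v
    simpa using hnonneg c hc hle v
  refine hne (Finsupp.ext fun v ↦ le_antisymm ?_ (hnonneg c hc hle v))
  simpa using hnonneg (-c) (neg_mem hc) (by simp [hneg]) v

end PositivesExceed

section Conformal

/-- `g` is conformal to `f` on `X`: where `g` does not vanish, it has the sign of `f`. -/
def ConformalOn {α : Type*} (X : Finset α) (g f : α → ℝ) : Prop :=
  ∀ v ∈ X, (0 < g v → 0 < f v) ∧ (g v < 0 → f v < 0)

variable {α : Type*} {X : Finset α} {f g k : α → ℝ}

lemma ConformalOn.trans (hgf : ConformalOn X g f) (hkg : ConformalOn X k g) :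
    ConformalOn X k f :=
  fun v hv ↦ ⟨(hgf v hv).1 ∘ (hkg v hv).1, (hgf v hv).2 ∘ (hkg v hv).2⟩

lemma ConformalOn.eq_zero (hgf : ConformalOn X g f) {v : α} (hv : v ∈ X) (hf : f v = 0) :
    g v = 0 :=
  le_antisymm (not_lt.1 fun hg ↦ ((hgf v hv).1 hg).ne' hf)
    (not_lt.1 fun hg ↦ ((hgf v hv).2 hg).ne hf)

lemma ConformalOn.of_eq_mul {a : α → ℝ} (ha : ∀ v ∈ X, 0 ≤ a v) (hg : ∀ v ∈ X, g v = f v * a v) :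
    ConformalOn X g f := by
  intro v hv
  rw [hg v hv]
  exact ⟨fun h ↦ pos_of_mul_pos_left h (ha v hv), fun h ↦ neg_of_mul_neg_left h (ha v hv)⟩

/-- Subtract the multiple of `k` for which the first coefficient of `f` vanishes, i.e. the one at
which `|k / f|` is largest. -/
lemma exists_conformalOn_sub_smul (hfk : ∀ v ∈ X, f v = 0 → k v = 0) {u : α} (hu : u ∈ X)
    (hku : k u ≠ 0) :
    ∃ t : ℝ, ConformalOn X (f - t • k) f ∧ ∃ v ∈ X, f v ≠ 0 ∧ (f - t • k) v = 0 := by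
  obtain ⟨w, hw, hmax⟩ := X.exists_max_image (fun v ↦ |k v / f v|) ⟨u, hu⟩
  have hkf : k w / f w ≠ 0 := by
    refine abs_pos.1 ((abs_pos.2 ?_).trans_le (hmax u hu))
    exact div_ne_zero hku (mt (hfk u hu) hku)
  obtain ⟨hkw, hfw⟩ := div_ne_zero_iff.1 hkf
  refine ⟨f w / k w, .of_eq_mul (a := fun v ↦ 1 - k v / f v / (k w / f w)) (fun v hv ↦ ?_)
    (fun v hv ↦ ?_), w, hw, hfw, ?_⟩
  · have hle : |k v / f v / (k w / f w)| ≤ 1 := by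
      rw [abs_div]
      exact div_le_one_of_le₀ (hmax v hv) (abs_nonneg _)
    linarith [le_abs_self (k v / f v / (k w / f w))]
  · by_cases hfv : f v = 0
    · simp [hfv, hfk v hv hfv]
    · simp only [Pi.sub_apply, Pi.smul_apply, smul_eq_mul]
      field_simp
  · simp [hkw]

lemma exists_conformalOn_minimal {L : Submodule ℝ (α → ℝ)} (X : Finset α) (hf : f ∈ L) {w : α}
    (hfw : f w ≠ 0) :
    ∃ g ∈ L, g w ≠ 0 ∧ ConformalOn X g f ∧
      ∀ k ∈ L, (∀ v ∈ X, g v = 0 → k v = 0) → k w = 0 → ∀ v ∈ X, k v = 0 := by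
  classical
  obtain ⟨g, ⟨hg, hgw, hgf⟩, hmin⟩ := exists_minimalFor_of_wellFoundedLT
    (fun g : α → ℝ ↦ g ∈ L ∧ g w ≠ 0 ∧ ConformalOn X g f) (fun g ↦ {v ∈ X | g v ≠ 0})
    ⟨f, hf, hfw, fun _ _ ↦ ⟨id, id⟩⟩
  refine ⟨g, hg, hgw, hgf, fun k hk hgk hkw u hu ↦ ?_⟩
  by_contra hku
  obtain ⟨t, hconf, v, hv, hgv, hzero⟩ := exists_conformalOn_sub_smul hgk hu hku
  have hle := hmin (j := g - t • k)
    ⟨L.sub_mem hg (L.smul_mem t hk), by simpa [hkw] using hgw, hgf.trans hconf⟩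
    (Finset.monotone_filter_right X fun v hv ↦ mt (hconf.eq_zero hv))
  exact (Finset.mem_filter.1 (hle (Finset.mem_filter.2 ⟨hv, hgv⟩))).2 hzero

variable {W : Type*} [AddCommGroup W] [Module ℝ W] {h : α → W} {A U : Finset α}

/-- The functional `φ` is nonnegative on the configuration `h '' X` and vanishes on `h '' A`. -/
def IsSupporting (h : α → W) (X A : Finset α) (φ : W →ₗ[ℝ] ℝ) : Prop :=
  (∀ v ∈ X, 0 ≤ φ (h v)) ∧ ∀ v ∈ A, φ (h v) = 0

lemma IsSupporting.mono {B : Finset α} {φ : W →ₗ[ℝ] ℝ} (hφ : IsSupporting h X B φ) (hAB : A ⊆ B) :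
    IsSupporting h X A φ :=
  ⟨hφ.1, fun v hv ↦ hφ.2 v (hAB hv)⟩

lemma IsConeFace.exists_isSupporting (hA : IsConeFace h X A) :
    ∃ φ, IsSupporting h X A φ ∧ ∀ v ∈ X, v ∉ A → 0 < φ (h v) := by
  obtain ⟨φ, hzero, hpos⟩ := hA
  refine ⟨φ, ⟨fun v hv ↦ ?_, hzero⟩, hpos⟩
  by_cases hvA : v ∈ A
  · exact (hzero v hvA).ge
  · exact (hpos v hv hvA).le

/-- A face missing `w` lies in a facet missing `w`. -/
lemma IsConeFace.exists_isSupporting_ker_le_span (hA : IsConeFace h X A) (hAX : A ⊆ X)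
    (hspan : Submodule.span ℝ (h '' X) = ⊤) {w : α} (hw : w ∈ X) (hwA : w ∉ A) :
    ∃ φ, IsSupporting h X A φ ∧ 0 < φ (h w) ∧
      LinearMap.ker φ ≤ Submodule.span ℝ (h '' {v ∈ X | φ (h v) = 0}) := by
  obtain ⟨φ₀, hφ₀, hpos⟩ := hA.exists_isSupporting
  let values : (W →ₗ[ℝ] ℝ) →ₗ[ℝ] (α → ℝ) := LinearMap.pi fun v ↦ LinearMap.applyₗ (h v)
  obtain ⟨_, ⟨φ, rfl⟩, hφw, hconf, hmin⟩ := exists_conformalOn_minimal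
    (L := LinearMap.range values) X ⟨φ₀, rfl⟩ (hpos w hw hwA).ne'
  have hnonneg (v) (hv : v ∈ X) : 0 ≤ φ (h v) :=
    not_lt.1 fun hlt ↦ (hφ₀.1 v hv).not_gt ((hconf v hv).2 hlt)
  have hφw' : 0 < φ (h w) := (hnonneg w hw).lt_of_ne' hφw
  refine ⟨φ, ⟨hnonneg, fun v hv ↦ hconf.eq_zero (hAX hv) (hφ₀.2 v hv)⟩, hφw', fun u hu ↦ ?_⟩
  have htop : Submodule.span ℝ (insert (h w) (h '' {v ∈ X | φ (h v) = 0})) = ⊤ := by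
    by_contra hne
    obtain ⟨ψ, hψ, hle⟩ := Submodule.exists_le_ker_of_lt_top _ (lt_top_iff_ne_top.2 hne)
    have hψZ := Submodule.span_le.1 hle
    have hψX := hmin _ ⟨ψ, rfl⟩ (fun v hv hv0 ↦ hψZ (.inr ⟨v, ⟨hv, hv0⟩, rfl⟩)) (hψZ (.inl rfl))
    refine hψ (LinearMap.ker_eq_top.1 (top_le_iff.1 (hspan ▸ Submodule.span_le.2 ?_)))
    rintro _ ⟨v, hv, rfl⟩
    exact hψX v hv
  obtain ⟨a, s, hs, rfl⟩ := Submodule.mem_span_insert.1 (htop ▸ Submodule.mem_top (x := u))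
  have hφs : φ s = 0 := by
    refine (Submodule.span_le (p := LinearMap.ker φ)).2 ?_ hs
    rintro _ ⟨v, hv, rfl⟩
    exact hv.2
  have ha : a = 0 := by simpa [hφs, hφw'.ne'] using hu
  simpa [ha] using hs

lemma exists_mem_dependences_linearIndepOn_erase [DecidableEq α] (hUX : U ⊆ X)
    (hU : LinearIndepOn ℝ h (U : Set α)) {c : α →₀ ℝ} (hc : c ∈ dependences h X) {z : α}
    (hcz : c z ≠ 0) :
    ∃ g ∈ dependences h X, g z ≠ 0 ∧ positives g \ U ⊆ positives c ∧
      LinearIndepOn ℝ h (((g.support ∪ U).erase z : Finset α) : Set α) := by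
  obtain ⟨_, ⟨g, hg, rfl⟩, hgz, hconf, hmin⟩ := exists_conformalOn_minimal
    (L := (dependences h X).map Finsupp.lcoeFun) (X \ U) ⟨c, hc, rfl⟩ hcz
  have hgX := (mem_dependences.1 hg).1
  refine ⟨g, hg, hgz, fun v hv ↦ ?_, ?_⟩
  · obtain ⟨hv, hvU⟩ := Finset.mem_sdiff.1 hv
    exact mem_positives.2 ((hconf v (Finset.mem_sdiff.2
      ⟨hgX (positives_subset_support hv), hvU⟩)).1 (mem_positives.1 hv))
  refine linearIndepOn_iff_dependences_eq_bot.2 ((Submodule.eq_bot_iff _).2 fun e he ↦ ?_)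
  have hsupp := (mem_dependences.1 he).1
  have heX : e ∈ dependences h X :=
    dependences_mono ((Finset.erase_subset _ _).trans (Finset.union_subset hgX hUX)) he
  have he0 := hmin e ⟨e, heX, rfl⟩ (fun v hv hgv ↦ Finsupp.notMem_support_iff.1 fun hev ↦ ?_)
    (Finsupp.notMem_support_iff.1 fun hez ↦ Finset.notMem_erase _ _ (hsupp hez))
  · have heU : e.support ⊆ U := fun v hv ↦ by
      by_contra hvU
      exact Finsupp.mem_support_iff.1 hv
        (he0 v (Finset.mem_sdiff.2 ⟨(mem_dependences.1 heX).1 hv, hvU⟩))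
    simpa [linearIndepOn_iff_dependences_eq_bot.1 hU] using
      mem_dependences_of_support_subset he heU
  · have hvgU := Finset.mem_of_mem_erase (hsupp hev)
    rw [Finset.mem_union, Finsupp.mem_support_iff] at hvgU
    exact hvgU.elim (· hgv) (Finset.mem_sdiff.1 hv).2

end Conformal

section Tower

variable {α : Type*} [DecidableEq α]

/-- The vertices `x₁, …, x_j, y₁, …, y_j` of the tower face `Φ_j`. -/
def towerVertices (x y : ℕ → α) (j : ℕ) : Finset α :=
  (Finset.Icc 1 j).image x ∪ (Finset.Icc 1 j).image y

variable {x y : ℕ → α} {j l : ℕ}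

lemma towerVertices_zero : towerVertices x y 0 = ∅ := by simp [towerVertices]

lemma towerVertices_mono (hjl : j ≤ l) : towerVertices x y j ⊆ towerVertices x y l :=
  Finset.union_subset_union (Finset.image_subset_image (Finset.Icc_subset_Icc_right hjl))
    (Finset.image_subset_image (Finset.Icc_subset_Icc_right hjl))

lemma towerVertices_succ :
    towerVertices x y (j + 1) = insert (x (j + 1)) (insert (y (j + 1)) (towerVertices x y j)) := by
  rw [towerVertices, ← Finset.insert_Icc_right_eq_Icc_add_one (by omega), Finset.image_insert,
    Finset.image_insert, Finset.insert_union, Finset.union_insert, towerVertices]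

end Tower

section SupportingFunctional

variable {α W : Type*} [AddCommGroup W] [Module ℝ W] [DecidableEq α] {h : α → W}
  {V Y A : Finset α} {z : α}

lemma IsSupporting.mul_apply_nonneg {φ : W →ₗ[ℝ] ℝ} (hφ : IsSupporting h V A φ) {c : α →₀ ℝ}
    (hc : c ∈ dependences h (insert z V)) (hpos : ∀ v ∈ V, 0 < c v → v ∈ A) :
    0 ≤ c z * φ (h z) := by
  by_contra! hlt
  have hle (v) (hv : v ∈ insert z V) : c v * φ (h v) ≤ 0 := by
    rcases Finset.mem_insert.1 hv with rfl | hvV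
    · exact hlt.le
    rcases le_or_gt (c v) 0 with hcv | hcv
    · exact mul_nonpos_of_nonpos_of_nonneg hcv (hφ.1 v hvV)
    · rw [hφ.2 v (hpos v hvV hcv), mul_zero]
  exact hlt.ne (mul_apply_eq_zero_of_nonpos hc φ hle z (Finset.mem_insert_self z V))

lemma mem_dependences_of_apply_eq_zero {c : α →₀ ℝ} (hc : c ∈ dependences h (insert z V))
    (hcz : c z = 0) : c ∈ dependences h V :=
  mem_dependences_of_support_subset hc fun v hv ↦
    (Finset.mem_insert.1 ((mem_dependences.1 hc).1 hv)).resolve_left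
      (by rintro rfl; exact Finsupp.mem_support_iff.1 hv hcz)

lemma positives_subset_of_apply_nonpos {c : α →₀ ℝ} (hc : c ∈ dependences h (insert z V))
    (hcz : c z ≤ 0) : positives c ⊆ V := fun _ hv ↦
  (Finset.mem_insert.1 ((mem_dependences.1 hc).1 (positives_subset_support hv))).resolve_left
    (by rintro rfl; exact hcz.not_gt (mem_positives.1 hv))

lemma exists_mem_dependences_of_mem_span (hz : z ∉ Y)
    (hspan : h z ∈ Submodule.span ℝ (h '' (Y : Set α))) :
    ∃ c ∈ dependences h (insert z Y), c z = -1 := by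
  obtain ⟨c, hcY, hc⟩ := (Finsupp.mem_span_image_iff_linearCombination ℝ).1 hspan
  rw [Finsupp.mem_supported, Finset.coe_subset] at hcY
  refine ⟨c - Finsupp.single z 1, mem_dependences.2 ⟨?_, by simp [hc]⟩, ?_⟩
  · exact Finsupp.support_sub.trans (Finset.union_subset (hcY.trans (Finset.subset_insert _ _))
      (Finsupp.support_single_subset.trans (by simp)))
  · simp [Finsupp.notMem_support_iff.1 (mt (@hcY z) hz)]

end SupportingFunctional

/-- The linear algebra behind sewing. The configuration `h '' V`, of rank `2 * m + 1`, stands for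
the homogenized vertices of a neighbourly `2 * m`-polytope with universal tower `x`, `y`, and `h z`
for the sewn point. The last field places `z`: a proper face containing `Φ_j` but not `Φ_{j + 1}`
lies in a facet beyond which (`j` odd) or beneath which (`j` even) `z` lies. -/
structure IsSewing {α W : Type*} [AddCommGroup W] [Module ℝ W] [DecidableEq α] (h : α → W)
    (V : Finset α) (z : α) (m : ℕ) (x y : ℕ → α) : Prop where
  pos : 0 < m
  finrank_eq : Module.finrank ℝ W = 2 * m + 1
  lt_card : 2 * m + 1 < V.card
  tower_subset : towerVertices x y m ⊆ V
  card_tower : ∀ j ≤ m, (towerVertices x y j).card = 2 * j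
  positivesExceed_tower : ∀ j ≤ m, PositivesExceed h V (towerVertices x y j) (m - j)
  exists_isSupporting : ∀ j ≤ m, ∀ A ⊆ V, IsConeFace h V A → towerVertices x y j ⊆ A →
    ∀ w ∈ V, w ∉ A → (j < m → w ∈ towerVertices x y (j + 1)) →
      ∃ φ, IsSupporting h V A φ ∧ 0 < (-1) ^ j * φ (h z)

namespace IsSewing

variable {α W : Type*} [AddCommGroup W] [Module ℝ W] [DecidableEq α] {h : α → W}
  {V Y A : Finset α} {z : α} {m i l : ℕ} {x y : ℕ → α} {c : α →₀ ℝ}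

lemma finiteDimensional (hS : IsSewing h V z m x y) : FiniteDimensional ℝ W :=
  Module.finite_of_finrank_pos (by rw [hS.finrank_eq]; omega)

lemma x_mem (hS : IsSewing h V z m x y) (hi : i < m) : x (i + 1) ∈ V :=
  hS.tower_subset (towerVertices_mono hi (by simp [towerVertices_succ]))

lemma linearIndepOn (hS : IsSewing h V z m x y) (hY : Y ⊆ V) (hcard : Y.card ≤ 2 * m + 1) :
    LinearIndepOn ℝ h (Y : Set α) := by
  refine (hS.positivesExceed_tower 0 (Nat.zero_le m)).linearIndepOn hY ?_
  simpa [towerVertices_zero] using hcard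

lemma span_image_eq_top (hS : IsSewing h V z m x y) (hY : Y ⊆ V) (hcard : Y.card = 2 * m + 1) :
    Submodule.span ℝ (h '' (Y : Set α)) = ⊤ := by
  have : FiniteDimensional ℝ W := hS.finiteDimensional
  have htop := (hS.linearIndepOn hY hcard.le).span_eq_top_of_card_eq_finrank'
    (by simp [hcard, hS.finrank_eq])
  rwa [Set.image_eq_range]

lemma card_sdiff_tower_add_two_le (hS : IsSewing h V z m x y) (hl : l < m)
    (hA : towerVertices x y (l + 1) ⊆ A ∪ towerVertices x y l) :
    (A \ towerVertices x y (l + 2)).card + 2 ≤ (A \ towerVertices x y l).card := by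
  have h2 : (towerVertices x y (l + 1) \ towerVertices x y l).card = 2 := by
    rw [Finset.card_sdiff_of_subset (towerVertices_mono l.le_succ), hS.card_tower _ hl,
      hS.card_tower _ hl.le]
    omega
  have hdisj : Disjoint (A \ towerVertices x y (l + 2))
      (towerVertices x y (l + 1) \ towerVertices x y l) :=
    Finset.disjoint_left.2 fun v hv hv' ↦ (Finset.mem_sdiff.1 hv).2
      (towerVertices_mono (l + 1).le_succ (Finset.mem_sdiff.1 hv').1)
  have hsub : A \ towerVertices x y (l + 2) ∪ (towerVertices x y (l + 1) \ towerVertices x y l) ⊆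
      A \ towerVertices x y l := by
    refine Finset.union_subset (Finset.sdiff_subset_sdiff le_rfl (towerVertices_mono (by omega))) ?_
    exact fun v hv ↦ by grind
  have hle := Finset.card_le_card hsub
  rwa [Finset.card_union_of_disjoint hdisj, h2] at hle

/-- Together with `Φ_l`, the set `A` forms a face. If that face swallows `Φ_{l + 1}`, then two
points of `A` are absorbed by the tower and the argument can be repeated for `l + 2`. -/
lemma exists_isSupporting_of_card_sdiff_le {l : ℕ} (hS : IsSewing h V z m x y)
    (hA : A ⊆ V) (hl : l ≤ m) (hcard : (A \ towerVertices x y l).card ≤ m - l) :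
    ∃ φ, IsSupporting h V A φ ∧ 0 < (-1) ^ l * φ (h z) := by
  have hTV : towerVertices x y l ⊆ V := (towerVertices_mono hl).trans hS.tower_subset
  have hface : IsConeFace h V (A ∪ towerVertices x y l) := by
    rw [← Finset.sdiff_union_self_eq_union]
    exact ((positivesExceed_iff hTV).1 (hS.positivesExceed_tower l hl)).2 _
      (Finset.sdiff_subset.trans hA) hcard
  by_cases hw : ∃ w ∈ V, w ∉ A ∪ towerVertices x y l ∧ (l < m → w ∈ towerVertices x y (l + 1))
  · obtain ⟨w, hwV, hwA, hwT⟩ := hw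
    obtain ⟨φ, hφ, hφz⟩ := hS.exists_isSupporting l hl _ (Finset.union_subset hA hTV) hface
      Finset.subset_union_right w hwV hwA hwT
    exact ⟨φ, hφ.mono Finset.subset_union_left, hφz⟩
  push Not at hw
  have hlm : l < m := by
    refine hl.lt_of_ne fun hlm ↦ ?_
    have hVA : V ⊆ (A \ towerVertices x y l) ∪ towerVertices x y l := by
      rw [Finset.sdiff_union_self_eq_union]
      intro v hv
      by_contra hvA
      exact (hw v hv hvA).1.ne hlm
    have hle := (Finset.card_le_card hVA).trans (Finset.card_union_le _ _)
    have hlt := hS.lt_card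
    rw [hS.card_tower l hl] at hle
    omega
  have hTA : towerVertices x y (l + 1) ⊆ A ∪ towerVertices x y l := by
    intro v hv
    by_contra hvA
    exact (hw v (hS.tower_subset (towerVertices_mono hlm hv)) hvA).2 hv
  have hcard' := hS.card_sdiff_tower_add_two_le hlm hTA
  obtain ⟨φ, hφ, hφz⟩ := exists_isSupporting_of_card_sdiff_le (l := l + 2) hS hA (by omega)
    (by omega)
  exact ⟨φ, hφ, by simpa [pow_add] using hφz⟩
termination_by m - l

lemma notMem (hS : IsSewing h V z m x y) : z ∉ V := by
  intro hz
  obtain ⟨φ, hφ, hφz⟩ := hS.exists_isSupporting_of_card_sdiff_le (A := ∅) (l := 1) (by simp)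
    hS.pos (by simp)
  linarith [hφ.1 z hz]

lemma neg_one_pow_mul_apply_nonneg (hS : IsSewing h V z m x y) (hc : c ∈ dependences h (insert z V))
    (hl : l ≤ m) (hcard : ((positives c).erase z \ towerVertices x y l).card ≤ m - l) :
    0 ≤ (-1) ^ l * c z := by
  have hA : (positives c).erase z ⊆ V :=
    Finset.subset_insert_iff.1 (positives_subset_support.trans (mem_dependences.1 hc).1)
  obtain ⟨φ, hφ, hφz⟩ := hS.exists_isSupporting_of_card_sdiff_le hA hl hcard
  have hmul : 0 ≤ c z * φ (h z) := hφ.mul_apply_nonneg hc fun v hv hcv ↦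
    Finset.mem_erase.2 ⟨ne_of_mem_of_not_mem hv hS.notMem, mem_positives.2 hcv⟩
  rcases neg_one_pow_eq_or ℝ l with hl' | hl' <;> rw [hl'] at hφz ⊢ <;> nlinarith

lemma positivesExceed_sewn (hS : IsSewing h V z m x y) (hi : i < m) :
    PositivesExceed h (insert z V) (insert z (insert (x (i + 1)) (towerVertices x y i)))
      (m - i - 1) := by
  intro c hc hne
  by_contra! hle
  have hT : towerVertices x y i ⊆ towerVertices x y (i + 1) := towerVertices_mono i.le_succ
  have hxT : x (i + 1) ∈ towerVertices x y (i + 1) := by simp [towerVertices_succ]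
  have hcz : c z = 0 := by
    have h0 := hS.neg_one_pow_mul_apply_nonneg hc hi.le <| calc
      _ ≤ (insert (x (i + 1)) (positives c \
            insert z (insert (x (i + 1)) (towerVertices x y i)))).card :=
          Finset.card_le_card fun v ↦ by grind
      _ ≤ m - i := (Finset.card_insert_le _ _).trans (by omega)
    have h1 := hS.neg_one_pow_mul_apply_nonneg hc (l := i + 1) hi <|
      (Finset.card_le_card fun v ↦ by grind).trans hle
    rw [pow_succ] at h1
    rcases neg_one_pow_eq_or ℝ i with hi' | hi' <;> rw [hi'] at h0 h1 <;> linarith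
  have hlt := hS.positivesExceed_tower (i + 1) hi c (mem_dependences_of_apply_eq_zero hc hcz) hne
  refine hlt.not_ge ((Finset.card_le_card fun v hv ↦ ?_).trans hle)
  have hvz : v ≠ z := by rintro rfl; simp [hcz] at hv
  grind

lemma lt_card_support_sdiff (hS : IsSewing h V z m x y) (hi : i < m)
    (hc : c ∈ dependences h (insert z V)) (hcz : 0 < (-1) ^ i * c z) (hcx : 0 ≤ c (x (i + 1))) :
    2 * (m - i) <
      (c.support \ insert z (insert (x (i + 1)) (towerVertices x y i))).card := by
  have hne : c ≠ 0 := by rintro rfl; simp at hcz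
  have hpos := hS.positivesExceed_sewn hi c hc hne
  have hneg : m - i < (positives (-c) \
      insert z (insert (x (i + 1)) (towerVertices x y i))).card := by
    by_contra! hle
    have hnonneg := hS.neg_one_pow_mul_apply_nonneg (neg_mem hc) hi.le <|
      (Finset.card_le_card fun v hv ↦ ?_).trans hle
    · simp only [Finsupp.neg_apply] at hnonneg
      linarith
    · have hvx : v ≠ x (i + 1) := by rintro rfl; simp [hcx.not_gt] at hv
      grind
  rw [← card_positives_sdiff_add_card_positives_neg_sdiff]
  omega

lemma lt_card_of_support_subset (hS : IsSewing h V z m x y) (hi : i < m)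
    (hc : c ∈ dependences h (insert z V)) (hcz : 0 < (-1) ^ i * c z) (hcx : 0 ≤ c (x (i + 1)))
    (hY : c.support ⊆ insert z (insert (x (i + 1)) Y)) (hTY : towerVertices x y i ⊆ Y) :
    2 * m < Y.card := by
  have hlt := hS.lt_card_support_sdiff hi hc hcz hcx
  have hle : _ ≤ (Y \ towerVertices x y i).card := Finset.card_le_card (s := c.support \
    insert z (insert (x (i + 1)) (towerVertices x y i))) fun v hv ↦ by grind
  rw [Finset.card_sdiff_of_subset hTY, hS.card_tower i hi.le] at hle
  omega

end IsSewing

lemma exists_mem_dependences_erase {α W : Type*} [AddCommGroup W] [Module ℝ W] [DecidableEq α]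
    {h : α → W} {Y : Finset α} {z w t : α} {b d : α →₀ ℝ} (hb : b ∈ dependences h (insert z Y))
    (hd : d ∈ dependences h (insert w Y)) (hzw : z ≠ w) (hzY : z ∉ Y) (hwY : w ∉ Y) (hdw : d w < 0)
    (hbt : 0 < b t) (hdt : 0 < d t) :
    ∃ e ∈ dependences h (insert z (insert w (Y.erase t))), e z = b z ∧ 0 < e w := by
  have hbY := (mem_dependences.1 hb).1
  have hdY := (mem_dependences.1 hd).1
  have hbw : b w = 0 := Finsupp.notMem_support_iff.1 fun hw ↦ by grind
  have hdz : d z = 0 := Finsupp.notMem_support_iff.1 fun hz ↦ by grind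
  have hmul : b t / d t * d w < 0 := mul_neg_of_pos_of_neg (div_pos hbt hdt) hdw
  have he : b - (b t / d t) • d ∈ dependences h (insert z (insert w Y)) :=
    sub_mem (dependences_mono (by grind) hb)
      (Submodule.smul_mem _ _ (dependences_mono (Finset.subset_insert _ _) hd))
  refine ⟨_, mem_dependences_of_support_subset he fun v hv ↦ ?_, by simp [hdz], by simp [hbw, hmul]⟩
  have hvt : v ≠ t := by rintro rfl; simp [hdt.ne'] at hv
  have := (mem_dependences.1 he).1 hv
  grind

namespace IsSewing

variable {α W : Type*} [AddCommGroup W] [Module ℝ W] [DecidableEq α] {h : α → W}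
  {V U : Finset α} {z : α} {m i k : ℕ} {x y : ℕ → α}

lemma even_of_positivesExceed (hS : IsSewing h V z m x y) (hi : i < m) (hk : k < m) (hUV : U ⊆ V)
    (hcard : U.card = 2 * k) (hTU : towerVertices x y i ⊆ U) (hxU : x (i + 1) ∉ U)
    (hV : PositivesExceed h V U (m - k)) (hzV : PositivesExceed h (insert z V) U (m - k)) :
    Even i := by
  by_contra hodd
  have hVcard := hS.lt_card
  have hxV := hS.x_mem hi
  obtain ⟨Y, hUY, hYV, hY⟩ := Finset.exists_subsuperset_card_eq (n := 2 * m + 1)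
    (Finset.subset_erase.2 ⟨hUV, hxU⟩) (by omega) (by rw [Finset.card_erase_of_mem hxV]; omega)
  obtain ⟨hYV, hxY⟩ := Finset.subset_erase.1 hYV
  have hzY : z ∉ Y := fun hzY ↦ hS.notMem (hYV hzY)
  have hspan (v : W) : v ∈ Submodule.span ℝ (h '' (Y : Set α)) :=
    hS.span_image_eq_top hYV hY ▸ Submodule.mem_top
  obtain ⟨b, hb, hbz⟩ := exists_mem_dependences_of_mem_span hzY (hspan (h z))
  obtain ⟨d, hd, hdx⟩ := exists_mem_dependences_of_mem_span hxY (hspan (h (x (i + 1))))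
  have hbpos := hzV b (dependences_mono (Finset.insert_subset_insert _ hYV) hb)
    (by rintro rfl; simp at hbz)
  have hdpos := hV d (dependences_mono (Finset.insert_subset hxV hYV) hd)
    (by rintro rfl; simp at hdx)
  obtain ⟨t, ht⟩ := Finset.inter_nonempty_of_card_lt_card_add_card
    (Finset.sdiff_subset_sdiff (positives_subset_of_apply_nonpos hb (by linarith)) (le_refl U))
    (Finset.sdiff_subset_sdiff (positives_subset_of_apply_nonpos hd (by linarith)) (le_refl U))
    (by rw [Finset.card_sdiff_of_subset hUY]; omega)
  obtain ⟨htb, htd⟩ := Finset.mem_inter.1 ht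
  obtain ⟨htb, htU⟩ := Finset.mem_sdiff.1 htb
  obtain ⟨e, he, hez, hex⟩ := exists_mem_dependences_erase hb hd
    (ne_of_mem_of_not_mem hxV hS.notMem).symm hzY hxY (by linarith) (mem_positives.1 htb)
    (mem_positives.1 (Finset.mem_sdiff.1 htd).1)
  have hlt := hS.lt_card_of_support_subset hi
    (dependences_mono (by grind) he) (by simp [hez, hbz, (Nat.not_even_iff_odd.1 hodd).neg_one_pow])
    hex.le (mem_dependences.1 he).1 (hTU.trans (Finset.subset_erase.2 ⟨hUY, htU⟩))
  rw [Finset.card_erase_of_mem (positives_subset_of_apply_nonpos hb (by linarith) htb)] at hlt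
  omega

lemma positivesExceed_insert (hS : IsSewing h V z m x y) (hi : i < m) (hk : k < m) (hUV : U ⊆ V)
    (hTU : towerVertices x y i ⊆ U) (hxU : x (i + 1) ∉ U) (heven : Even i)
    (hzV : PositivesExceed h (insert z V) U (m - k)) :
    PositivesExceed h (insert z V) (insert z (insert (x (i + 1)) U)) (m - k - 1) := by
  intro c hc hne
  by_contra! hle
  have hcz := hzV.pos_of_card_sdiff_insert_lt hc hne (a := z) (b := x (i + 1)) (by omega)
  obtain ⟨g, hg, hgz, hgc, hind⟩ := exists_mem_dependences_linearIndepOn_erase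
    (hUV.trans (Finset.subset_insert z V)) (hzV.linearIndepOn
      (hUV.trans (Finset.subset_insert z V)) (by simp)) hc hcz.ne'
  have hgne : g ≠ 0 := by rintro rfl; simp at hgz
  have hsub : positives g \ insert z (insert (x (i + 1)) U) ⊆
      positives c \ insert z (insert (x (i + 1)) U) := fun v hv ↦ by grind
  have hgcard : (positives g \ insert z (insert (x (i + 1)) U)).card < m - k :=
    (Finset.card_le_card hsub).trans_lt (by omega)
  have hgz := hzV.pos_of_card_sdiff_insert_lt hg hgne hgcard
  rw [Finset.insert_comm] at hgcard
  have hgx := hzV.pos_of_card_sdiff_insert_lt hg hgne hgcard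
  have hxY : x (i + 1) ∈ (g.support ∪ U).erase z := Finset.mem_erase.2
    ⟨ne_of_mem_of_not_mem (hS.x_mem hi) hS.notMem, by simp [hgx.ne']⟩
  have hle : ((g.support ∪ U).erase z).card ≤ 2 * m + 1 := by
    have : FiniteDimensional ℝ W := hS.finiteDimensional
    rw [← hS.finrank_eq]
    exact (Fintype.card_coe _).symm.trans_le (LinearIndependent.fintype_card_le_finrank hind)
  have hlt := hS.lt_card_of_support_subset hi hg (by simpa [heven.neg_one_pow] using hgz) hgx.le
    (Y := ((g.support ∪ U).erase z).erase (x (i + 1))) (fun v hv ↦ by grind) fun v hv ↦ ?_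
  · rw [Finset.card_erase_of_mem hxY] at hlt
    omega
  · have hvU := hTU hv
    have hvz : v ≠ z := ne_of_mem_of_not_mem (hUV hvU) hS.notMem
    grind

lemma positivesExceed_of_insert (hS : IsSewing h V z m x y) (hi : i < m) (hk : k < m) (hUV : U ⊆ V)
    (hTU : towerVertices x y i ⊆ U) (hxU : x (i + 1) ∉ U) (heven : Even i)
    (hV : PositivesExceed h V U (m - k))
    (hzxU : PositivesExceed h (insert z V) (insert z (insert (x (i + 1)) U)) (m - k - 1)) :
    PositivesExceed h (insert z V) U (m - k) := by
  intro c hc hne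
  by_contra! hle
  have hUzx : U ⊆ insert z (insert (x (i + 1)) U) := by grind
  have hcz : c z ≤ 0 := hzxU.nonpos_of_card_sdiff_le hUzx hc hne (by omega) (by simp)
    fun hzU ↦ hS.notMem (hUV hzU)
  have hcx : c (x (i + 1)) ≤ 0 :=
    hzxU.nonpos_of_card_sdiff_le hUzx hc hne (by omega) (by simp) hxU
  have hposV := positives_subset_of_apply_nonpos hc hcz
  have hface : IsConeFace h V (positives c \ U ∪ U) :=
    ((positivesExceed_iff hUV).1 hV).2 _ (Finset.sdiff_subset.trans hposV) hle
  obtain ⟨φ, hφ, hφz⟩ := hS.exists_isSupporting i hi.le _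
    (Finset.union_subset (Finset.sdiff_subset.trans hposV) hUV) hface
    (hTU.trans Finset.subset_union_right) (x (i + 1)) (hS.x_mem hi)
    (by simp [hxU, hcx.not_gt]) fun _ ↦ by simp [towerVertices_succ]
  rw [heven.neg_one_pow, one_mul] at hφz
  have hmul : 0 ≤ c z * φ (h z) := hφ.mul_apply_nonneg hc fun v _ hcv ↦ by
    by_cases hvU : v ∈ U <;> simp [hvU, hcv]
  have hcz0 : c z = 0 := le_antisymm hcz (nonneg_of_mul_nonneg_left hmul hφz)
  exact (hV c (mem_dependences_of_apply_eq_zero hc hcz0) hne).not_ge hle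

lemma positivesExceed_iff_even (hS : IsSewing h V z m x y) (hi : i < m) (hk : k < m) (hUV : U ⊆ V)
    (hcard : U.card = 2 * k) (hTU : towerVertices x y i ⊆ U) (hxU : x (i + 1) ∉ U)
    (hV : PositivesExceed h V U (m - k)) :
    PositivesExceed h (insert z V) U (m - k) ↔ Even i ∧
      PositivesExceed h (insert z V) (insert z (insert (x (i + 1)) U)) (m - k - 1) := by
  refine ⟨fun hzV ↦ ?_, fun ⟨heven, hzxU⟩ ↦
    hS.positivesExceed_of_insert hi hk hUV hTU hxU heven hV hzxU⟩
  have heven := hS.even_of_positivesExceed hi hk hUV hcard hTU hxU hV hzV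
  exact ⟨heven, hS.positivesExceed_insert hi hk hUV hTU hxU heven hzV⟩

lemma linearIndepOn_insert (hS : IsSewing h V z m x y) (hi : i < m) (hk : k < m) (hUV : U ⊆ V)
    (hcard : U.card = 2 * k) (hTU : towerVertices x y i ⊆ U) :
    LinearIndepOn ℝ h (↑(insert z (insert (x (i + 1)) U)) : Set α) := by
  refine (hS.positivesExceed_sewn hi).linearIndepOn (Finset.insert_subset_insert _
    (Finset.insert_subset (hS.x_mem hi) hUV)) ?_
  have hle : (insert z (insert (x (i + 1)) U) \
      insert z (insert (x (i + 1)) (towerVertices x y i))).card ≤ (U \ towerVertices x y i).card :=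
    Finset.card_le_card fun v hv ↦ by grind
  rw [Finset.card_sdiff_of_subset hTU, hcard, hS.card_tower i hi.le] at hle
  omega

lemma isUniversalIn_sewn_iff (hS : IsSewing h V z m x y) (hi : i < m) (hk : k < m) (hUV : U ⊆ V)
    (hcard : U.card = 2 * k) (hTU : towerVertices x y i ⊆ U) (hxU : x (i + 1) ∉ U)
    (hU : IsUniversalIn h V U (m - k)) :
    IsUniversalIn h (insert z V) U (m - k) ↔ Even i ∧
      IsUniversalIn h (insert z V) (insert z (insert (x (i + 1)) U)) (m - k - 1) := by
  have hind : LinearIndepOn ℝ h (U : Set α) := hS.linearIndepOn hUV (by omega)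
  have hindzx := hS.linearIndepOn_insert hi hk hUV hcard hTU
  have hiff := hS.positivesExceed_iff_even hi hk hUV hcard hTU hxU
    ((positivesExceed_iff hUV).2 ⟨hind, hU⟩)
  rw [positivesExceed_iff (hUV.trans (Finset.subset_insert z V)), positivesExceed_iff
    (Finset.insert_subset_insert z (Finset.insert_subset (hS.x_mem hi) hUV))] at hiff
  simpa only [hind, hindzx, true_and] using hiff

lemma isConeFace_singleton {v : α} (hS : IsSewing h V z m x y) (hm : 1 < m) (hv : v ∈ insert z V) :
    IsConeFace h (insert z V) {v} := by
  have huniv := ((positivesExceed_iff (Finset.empty_subset _)).1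
    ((hS.positivesExceed_sewn hS.pos).mono (Finset.empty_subset _))).2
  simpa using huniv {v} (Finset.singleton_subset_iff.2 hv) (by rw [Finset.card_singleton]; omega)

end IsSewing

section Homogenization

variable {E : Type*} [NormedAddCommGroup E] [NormedSpace ℝ E] {s P F : Set E} {p q z w : E}
  {φ : E × ℝ →ₗ[ℝ] ℝ}

/-- The homogenization `p ↦ (p, 1)`, which turns affine conditions on points of `E` into linear
conditions on vectors of `E × ℝ`. -/
def homog : E →ᵃ[ℝ] E × ℝ := (AffineMap.id ℝ E).prod (AffineMap.const ℝ E 1)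

/-- The part of `P` on which the affine functional `p ↦ φ (p, 1)` vanishes. -/
def zeroFace (P : Set E) (φ : E × ℝ →ₗ[ℝ] ℝ) : Set E := {p ∈ P | φ (homog p) = 0}

@[simp]
lemma homog_apply : homog p = (p, (1 : ℝ)) := rfl

lemma homog_mem_span_image_iff :
    homog p ∈ Submodule.span ℝ (homog '' s) ↔ p ∈ affineSpan ℝ s := by
  refine ⟨fun hp ↦ ?_, fun hp ↦ ?_⟩
  · rcases s.eq_empty_or_nonempty with rfl | ⟨a, ha⟩
    · simp at hp
    let shear : E × ℝ →ₗ[ℝ] E :=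
      LinearMap.fst ℝ E ℝ - (LinearMap.snd ℝ E ℝ).smulRight a
    have hle : Submodule.span ℝ (homog '' s) ≤ (vectorSpan ℝ s).comap shear := by
      refine Submodule.span_le.2 ?_
      rintro _ ⟨v, hv, rfl⟩
      simpa [shear] using vsub_mem_vectorSpan ℝ hv ha
    rw [← AffineSubspace.vsub_right_mem_direction_iff_mem (subset_affineSpan ℝ s ha),
      direction_affineSpan]
    simpa [shear] using hle hp
  · have hle : affineSpan ℝ s ≤ (Submodule.span ℝ (homog '' s)).toAffineSubspace.comap homog :=
      affineSpan_le.2 fun v hv ↦ Submodule.subset_span (Set.mem_image_of_mem homog hv)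
    exact hle hp

lemma finrank_span_homog_image [FiniteDimensional ℝ E] (hs : s.Nonempty) :
    Module.finrank ℝ (Submodule.span ℝ (homog '' s)) = affDim s + 1 := by
  obtain ⟨a, ha⟩ := hs
  set S := Submodule.span ℝ (homog '' s)
  have haS : homog a ∈ S := Submodule.subset_span (Set.mem_image_of_mem homog ha)
  have hrange : LinearMap.range ((LinearMap.snd ℝ E ℝ).domRestrict S) = ⊤ :=
    LinearMap.range_eq_top.2 fun t ↦ ⟨t • ⟨homog a, haS⟩, by simp⟩
  have hmem (v : E) : (v, (0 : ℝ)) ∈ S ↔ v ∈ vectorSpan ℝ s := by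
    rw [← Submodule.add_mem_iff_left S haS, ← direction_affineSpan,
      ← AffineSubspace.vadd_mem_iff_mem_direction v (subset_affineSpan ℝ s ha),
      ← homog_mem_span_image_iff]
    simp [S]
  have hker : S ⊓ LinearMap.ker (LinearMap.snd ℝ E ℝ) =
      (vectorSpan ℝ s).map (LinearMap.inl ℝ E ℝ) := by
    ext ⟨v, t⟩
    simp only [Submodule.mem_inf, LinearMap.mem_ker, LinearMap.snd_apply, Submodule.mem_map,
      LinearMap.inl_apply, Prod.mk.injEq, ← hmem]
    aesop
  have hsum := LinearMap.finrank_range_add_finrank_ker ((LinearMap.snd ℝ E ℝ).domRestrict S)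
  rw [hrange, finrank_top, Module.finrank_self, LinearMap.ker_domRestrict,
    ← Submodule.finrank_map_subtype_eq, Submodule.map_comap_subtype, hker,
    ← (Submodule.equivMapOfInjective _ LinearMap.inl_injective _).finrank_eq] at hsum
  rw [affDim, ← hsum, add_comm]

lemma wOppSide_iff_mul_nonpos {L : AffineSubspace ℝ E} {f : E →ᵃ[ℝ] ℝ}
    (hL : ∀ p, p ∈ L ↔ f p = 0) : L.WOppSide p q ↔ f p * f q ≤ 0 := by
  have hseg : (0 : ℝ) ∈ f '' segment ℝ p q ↔ f p * f q ≤ 0 := by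
    rw [image_segment, segment_eq_uIcc, Set.mem_uIcc, mul_nonpos_iff]
    tauto
  simp only [AffineSubspace.wOppSide_iff_exists_wbtw, ← mem_segment_iff_wbtw, ← hseg, hL,
    Set.mem_image, and_comm]

lemma isBeyond_iff (hF : ∀ p, p ∈ affineSpan ℝ F ↔ φ (homog p) = 0)
    (hφ : ∀ p ∈ P, 0 ≤ φ (homog p)) (hwP : w ∈ P) (hw : 0 < φ (homog w)) :
    IsBeyond P F z ↔ φ (homog z) < 0 := by
  have hside (p) : (affineSpan ℝ F).WOppSide p z ↔ φ (homog p) * φ (homog z) ≤ 0 :=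
    wOppSide_iff_mul_nonpos (f := φ.toAffineMap.comp homog) hF
  simp only [IsBeyond, hF, hside]
  refine ⟨fun ⟨hne, hle⟩ ↦ ((nonpos_of_mul_nonpos_right (hle w hwP) hw)).lt_of_ne hne,
    fun hlt ↦ ⟨hlt.ne, fun p hp ↦ mul_nonpos_of_nonneg_of_nonpos (hφ p hp) hlt.le⟩⟩

lemma isBeneath_iff (hF : ∀ p, p ∈ affineSpan ℝ F ↔ φ (homog p) = 0)
    (hφ : ∀ p ∈ P, 0 ≤ φ (homog p)) (hwP : w ∈ P) (hw : 0 < φ (homog w)) :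
    IsBeneath P F z ↔ 0 < φ (homog z) := by
  rw [IsBeneath, isBeyond_iff hF hφ hwP hw, hF, not_lt, lt_iff_le_and_ne, and_comm, ne_comm]

lemma isFace_zeroFace [FiniteDimensional ℝ E] (hφ : ∀ p ∈ P, 0 ≤ φ (homog p)) :
    IsFace P (zeroFace P φ) := by
  rintro ⟨a, haP, ha⟩
  let l : StrongDual ℝ E := LinearMap.toContinuousLinearMap (-(φ ∘ₗ LinearMap.inl ℝ E ℝ))
  have hl (p) : l p = φ (0, 1) - φ (homog p) := by
    rw [← map_sub]
    simp [l, ← map_neg]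
  refine ⟨l, Set.ext fun p ↦ and_congr_right fun hp ↦ ?_⟩
  simp only [hl, sub_le_sub_iff_left]
  exact ⟨fun h q hq ↦ h ▸ hφ q hq, fun h ↦ le_antisymm ((h a haP).trans_eq ha) (hφ p hp)⟩

end Homogenization

section Polytope

variable {E : Type*} [NormedAddCommGroup E] [NormedSpace ℝ E] {s P F : Set E} {V A : Finset E}
  {φ : E × ℝ →ₗ[ℝ] ℝ}

lemma affDim_convexHull : affDim (convexHull ℝ s) = affDim s := by
  rw [affDim, ← direction_affineSpan, affineSpan_convexHull, direction_affineSpan, affDim]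

lemma apply_homog_nonneg_of_mem_convexHull (hφ : ∀ v ∈ s, 0 ≤ φ (homog v)) :
    ∀ p ∈ convexHull ℝ s, 0 ≤ φ (homog p) :=
  convexHull_min hφ ((convex_Ici (0 : ℝ)).affine_preimage (φ.toAffineMap.comp homog))

lemma convexHull_extremePoints_eq (hP : IsCompact P) (hconv : Convex ℝ P)
    (hfin : (P.extremePoints ℝ).Finite) : convexHull ℝ (P.extremePoints ℝ) = P := by
  rw [← (hfin.isClosed_convexHull ℝ).closure_eq, closure_convexHull_extremePoints hP hconv]

lemma IsPolytope.exists_eq_convexHull (hP : IsPolytope P) :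
    ∃ V : Finset E, P = convexHull ℝ (V : Set E) ∧ vertices (convexHull ℝ (V : Set E)) = V := by
  obtain ⟨s, -, rfl⟩ := hP
  have hfin : (vertices (convexHull ℝ (s : Set E))).Finite :=
    s.finite_toSet.subset extremePoints_convexHull_subset
  have heq := convexHull_extremePoints_eq (s.finite_toSet.isCompact_convexHull ℝ)
    (convex_convexHull ℝ _) hfin
  exact ⟨hfin.toFinset, by rw [hfin.coe_toFinset, heq], by rw [hfin.coe_toFinset, heq]⟩

lemma IsFace.convexHull_inter_eq (hF : IsFace (convexHull ℝ s) F) (hs : s.Finite) :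
    convexHull ℝ (s ∩ F) = F := by
  have hconv : Convex ℝ F := hF.convex (convex_convexHull ℝ s)
  have hsub : F.extremePoints ℝ ⊆ s :=
    hF.isExtreme.extremePoints_subset_extremePoints.trans extremePoints_convexHull_subset
  refine (convexHull_min Set.inter_subset_right hconv).antisymm ?_
  calc F = convexHull ℝ (F.extremePoints ℝ) := (convexHull_extremePoints_eq
        (hF.isCompact (hs.isCompact_convexHull ℝ)) hconv (hs.subset hsub)).symm
    _ ⊆ convexHull ℝ (s ∩ F) := convexHull_mono (Set.subset_inter hsub extremePoints_subset)

lemma mem_convexHull_iff_of_subset_vertices (hA : (A : Set E) ⊆ vertices P) {v : E}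
    (hP : Convex ℝ P) (hv : v ∈ vertices P) : v ∈ convexHull ℝ (A : Set E) ↔ v ∈ A := by
  refine ⟨fun hvA ↦ ?_, fun hvA ↦ subset_convexHull ℝ _ hvA⟩
  exact extremePoints_convexHull_subset (inter_extremePoints_subset_extremePoints_of_subset
    (convexHull_min (hA.trans extremePoints_subset) hP) ⟨hvA, hv⟩)

lemma IsConeFace.isFace [FiniteDimensional ℝ E] (hface : IsConeFace homog V A) (hA : A ⊆ V) :
    IsFace (convexHull ℝ (V : Set E)) (convexHull ℝ (A : Set E)) := by
  obtain ⟨φ, hφ, hpos⟩ := hface.exists_isSupporting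
  have hzero := isFace_zeroFace (P := convexHull ℝ (V : Set E))
    (apply_homog_nonneg_of_mem_convexHull hφ.1)
  suffices heq : (V : Set E) ∩ zeroFace (convexHull ℝ V) φ = A by
    rwa [← hzero.convexHull_inter_eq V.finite_toSet, heq] at hzero
  ext v
  refine ⟨fun ⟨hv, _, hv0⟩ ↦ by_contra fun hvA ↦ (hpos v hv hvA).ne' hv0, fun hv ↦ ?_⟩
  exact ⟨hA hv, subset_convexHull ℝ _ (hA hv), hφ.2 v hv⟩

lemma IsFace.isConeFace (hface : IsFace (convexHull ℝ (V : Set E)) (convexHull ℝ (A : Set E)))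
    (hV : vertices (convexHull ℝ (V : Set E)) = V) (hA : A ⊆ V) : IsConeFace homog V A := by
  rcases A.eq_empty_or_nonempty with rfl | ⟨a, ha⟩
  · exact ⟨LinearMap.snd ℝ E ℝ, by simp, fun v _ _ ↦ by simp⟩
  have haA : a ∈ convexHull ℝ (A : Set E) := subset_convexHull ℝ _ ha
  obtain ⟨l, hl⟩ := hface ⟨a, haA⟩
  have hmem (p : E) : p ∈ convexHull ℝ (A : Set E) ↔
      p ∈ convexHull ℝ (V : Set E) ∧ ∀ q ∈ convexHull ℝ (V : Set E), l q ≤ l p := by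
    conv_lhs => rw [hl]
    rfl
  have hmax := ((hmem a).1 haA).2
  refine ⟨l a • LinearMap.snd ℝ E ℝ - l.toLinearMap ∘ₗ LinearMap.fst ℝ E ℝ, fun v hv ↦ ?_,
    fun v hv hvA ↦ ?_⟩
  · have hvmem := (hmem v).1 (subset_convexHull ℝ _ hv)
    simpa [sub_eq_zero] using (hvmem.2 a ((hmem a).1 haA).1).antisymm (hmax v hvmem.1)
  · have hvP : v ∈ convexHull ℝ (V : Set E) := subset_convexHull ℝ _ hv
    rw [← Finset.mem_coe, ← hV] at hv
    rw [← mem_convexHull_iff_of_subset_vertices (by rwa [hV, Finset.coe_subset])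
      (convex_convexHull ℝ _) hv, hmem] at hvA
    push Not at hvA
    obtain ⟨q, hq, hlt⟩ := hvA hvP
    simpa using hlt.trans_le (hmax q hq)

lemma isConeFace_homog_iff [FiniteDimensional ℝ E] (hV : vertices (convexHull ℝ (V : Set E)) = V)
    (hA : A ⊆ V) :
    IsConeFace homog V A ↔ IsFace (convexHull ℝ (V : Set E)) (convexHull ℝ (A : Set E)) :=
  ⟨fun h ↦ h.isFace hA, fun h ↦ h.isConeFace hV hA⟩

lemma vertices_convexHull_eq [FiniteDimensional ℝ E] (hV : ∀ v ∈ V, IsConeFace homog V {v}) :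
    vertices (convexHull ℝ (V : Set E)) = V := by
  refine extremePoints_convexHull_subset.antisymm fun v hv ↦ ?_
  have hface := (hV v hv).isFace (Finset.singleton_subset_iff.2 hv)
  rw [Finset.coe_singleton, convexHull_singleton] at hface
  exact exposedPoints_subset_extremePoints (mem_exposedPoints_iff_exposed_singleton.2 hface)

end Polytope

section Facet

variable {E : Type*} [NormedAddCommGroup E] [NormedSpace ℝ E] {s P : Set E}
  {φ : E × ℝ →ₗ[ℝ] ℝ}

lemma span_homog_image_eq_top [FiniteDimensional ℝ E] (hs : s.Nonempty)
    (hdim : affDim s = Module.finrank ℝ E) : Submodule.span ℝ (homog '' s) = ⊤ :=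
  Submodule.eq_top_of_finrank_eq (by
    rw [finrank_span_homog_image hs, hdim, Module.finrank_prod, Module.finrank_self])

lemma span_homog_image_zeroFace
    (hker : LinearMap.ker φ ≤ Submodule.span ℝ (homog '' zeroFace P φ)) :
    Submodule.span ℝ (homog '' zeroFace P φ) = LinearMap.ker φ :=
  (Submodule.span_le.2 (by rintro _ ⟨v, hv, rfl⟩; exact hv.2)).antisymm hker

lemma mem_affineSpan_zeroFace_iff
    (hker : LinearMap.ker φ ≤ Submodule.span ℝ (homog '' zeroFace P φ)) (p : E) :
    p ∈ affineSpan ℝ (zeroFace P φ) ↔ φ (homog p) = 0 := by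
  rw [← homog_mem_span_image_iff, span_homog_image_zeroFace hker, LinearMap.mem_ker]

lemma isFacet_zeroFace [FiniteDimensional ℝ E] (hφ : ∀ p ∈ P, 0 ≤ φ (homog p)) (hφ0 : φ ≠ 0)
    (hdim : affDim P = Module.finrank ℝ E) (hpos : 0 < affDim P)
    (hker : LinearMap.ker φ ≤ Submodule.span ℝ (homog '' zeroFace P φ)) :
    IsFacet P (zeroFace P φ) := by
  have hrank := Module.Dual.finrank_ker_add_one_of_ne_zero hφ0
  rw [Module.finrank_prod, Module.finrank_self, add_left_inj, ← hdim] at hrank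
  have hspan := span_homog_image_zeroFace hker
  have hne : (zeroFace P φ).Nonempty := by
    by_contra! hempty
    rw [← hspan, hempty, Set.image_empty, Submodule.span_empty, finrank_bot] at hrank
    exact hpos.ne hrank
  refine ⟨hne, isFace_zeroFace hφ, ?_⟩
  rw [← finrank_span_homog_image hne, hspan, hrank]

end Facet

section Cardinality

variable {α W : Type*} [AddCommGroup W] [Module ℝ W] {h : α → W} {A : Finset α}

lemma finrank_span_image_eq_card (hind : LinearIndepOn ℝ h (A : Set α)) :
    Module.finrank ℝ (Submodule.span ℝ (h '' A)) = A.card := by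
  rw [Set.image_eq_range]
  simpa using finrank_span_eq_card hind

lemma card_eq_finrank_span_image [FiniteDimensional ℝ W] {n : ℕ}
    (hind : ∀ Y ⊆ A, Y.card ≤ n → LinearIndepOn ℝ h (Y : Set α))
    (hlt : Module.finrank ℝ (Submodule.span ℝ (h '' A)) < n) :
    A.card = Module.finrank ℝ (Submodule.span ℝ (h '' A)) := by
  suffices hle : A.card ≤ n from (finrank_span_image_eq_card (hind A subset_rfl hle)).symm
  by_contra! hcard
  obtain ⟨Y, hY, hYcard⟩ := Finset.exists_subset_card_eq hcard.le
  have hmono := Submodule.finrank_mono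
    (Submodule.span_mono (R := ℝ) (Set.image_mono (f := h) (Finset.coe_subset.2 hY)))
  rw [finrank_span_image_eq_card (hind Y hY hYcard.le), hYcard] at hmono
  exact hmono.not_gt hlt

end Cardinality

section UniversalFace

variable {E : Type*} [NormedAddCommGroup E] [NormedSpace ℝ E] [FiniteDimensional ℝ E]
  {V A : Finset E} {d : ℕ}

lemma affDim_add_one_eq_card (hA : A.Nonempty) (hind : LinearIndepOn ℝ homog (A : Set E)) :
    affDim (A : Set E) + 1 = A.card := by
  rw [← finrank_span_homog_image (Finset.coe_nonempty.2 hA), finrank_span_image_eq_card hind]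

lemma isUniversalFace_convexHull_iff [DecidableEq E]
    (hV : vertices (convexHull ℝ (V : Set E)) = V) (hA : A ⊆ V)
    (hind : LinearIndepOn ℝ homog (A : Set E)) (hcard : A.card = d + 1) :
    IsUniversalFace (convexHull ℝ (V : Set E)) d (convexHull ℝ (A : Set E)) ↔
      IsUniversalIn homog V A ((affDim (convexHull ℝ (V : Set E)) - d - 1) / 2) := by
  have hne : A.Nonempty := Finset.card_pos.1 (by omega)
  have hdim : affDim (convexHull ℝ (A : Set E)) = d := by
    rw [affDim_convexHull, ← add_left_inj, affDim_add_one_eq_card hne hind, hcard]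
  have hface (S : Finset E) (hS : S ⊆ V) : IsConeFace homog V (S ∪ A) ↔
      IsFace (convexHull ℝ (V : Set E)) (convexHull ℝ (S ∪ convexHull ℝ (A : Set E))) := by
    rw [isConeFace_homog_iff hV (Finset.union_subset hS hA), Finset.coe_union,
      convexHull_convexHull_union_right]
  rw [IsUniversalFace, hV]
  refine ⟨fun hU S hS hScard ↦ (hface S hS).2 (hU.2 S (Finset.coe_subset.2 hS) hScard),
    fun hU ↦ ⟨⟨(Finset.coe_nonempty.2 hne).convexHull, ?_, hdim⟩, fun S hS hScard ↦
      (hface S (Finset.coe_subset.1 hS)).1 (hU S (Finset.coe_subset.1 hS) hScard)⟩⟩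
  rw [← isConeFace_homog_iff hV hA]
  simpa using hU ∅ (by simp) (by simp)

end UniversalFace

section Tower

variable {E : Type*} [NormedAddCommGroup E] [NormedSpace ℝ E] {P F : Set E} {x y : ℕ → E}
  {m j l : ℕ}

lemma towerFace_mono (hjl : j ≤ l) : towerFace x y j ⊆ towerFace x y l :=
  convexHull_mono (by gcongr)

lemma mem_towerFacets_iff (hF : IsFacet P F) (hj : j ≤ m) (hjF : towerFace x y j ⊆ F)
    (hsucc : j < m → ¬ towerFace x y (j + 1) ⊆ F) : F ∈ towerFacets P m x y ↔ Odd j := by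
  have hthrough (l) : F ∈ facetsThrough P m x y l ↔ l ≤ j := by
    refine ⟨fun ⟨hlm, _, hl⟩ ↦ ?_, fun hlj ↦ ⟨hlj.trans hj, hF, (towerFace_mono hlj).trans hjF⟩⟩
    by_contra! hjl
    exact hsucc (hjl.trans_le hlm) ((towerFace_mono hjl).trans hl)
  simp only [towerFacets, Set.mem_iUnion, Set.mem_sdiff, hthrough]
  exact ⟨fun ⟨r, _, _⟩ ↦ ⟨r, by omega⟩, fun ⟨r, _⟩ ↦ ⟨r, by omega, by omega⟩⟩

variable [DecidableEq E] {V A : Finset E} {z w : E}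

lemma towerFace_eq_convexHull : towerFace x y j = convexHull ℝ (towerVertices x y j : Set E) := by
  simp [towerFace, towerVertices]

lemma IsNeighbourly.positivesExceed_empty (hP : IsNeighbourly (convexHull ℝ (V : Set E)))
    (hV : vertices (convexHull ℝ (V : Set E)) = V)
    (hcard : affDim (convexHull ℝ (V : Set E)) / 2 < V.card) :
    PositivesExceed homog V ∅ (affDim (convexHull ℝ (V : Set E)) / 2) :=
  positivesExceed_empty_of_isConeFace hcard fun S hS hScard ↦
    (hP.2 S (by rwa [hV, Finset.coe_subset]) hScard).1.isConeFace hV hS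

namespace IsUniversalTower

lemma towerVertices_subset (hT : IsUniversalTower P m x y) :
    (towerVertices x y m : Set E) ⊆ vertices P := by
  simp only [towerVertices, Finset.coe_union, Finset.coe_image, Finset.coe_Icc,
    Set.union_subset_iff, Set.image_subset_iff]
  exact ⟨hT.x_mem, hT.y_mem⟩

lemma card_towerVertices (hT : IsUniversalTower P m x y) (hj : j ≤ m) :
    (towerVertices x y j).card = 2 * j := by
  have hsub : Set.Icc 1 j ⊆ Set.Icc 1 m := Set.Icc_subset_Icc_right hj
  have hdisj : Disjoint ((Finset.Icc 1 j).image x) ((Finset.Icc 1 j).image y) := by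
    simp only [Finset.disjoint_left, Finset.mem_image, Finset.mem_Icc]
    rintro _ ⟨l, hl, rfl⟩ ⟨l', hl', heq⟩
    exact hT.x_ne_y l (hsub hl) l' (hsub hl') heq.symm
  rw [towerVertices, Finset.card_union_of_disjoint hdisj, Finset.card_image_of_injOn,
    Finset.card_image_of_injOn, Nat.card_Icc]
  · omega
  · simpa using hT.y_injOn.mono hsub
  · simpa using hT.x_injOn.mono hsub

lemma positivesExceed [FiniteDimensional ℝ E]
    (hT : IsUniversalTower (convexHull ℝ (V : Set E)) m x y)
    (hV : vertices (convexHull ℝ (V : Set E)) = V)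
    (hdim : affDim (convexHull ℝ (V : Set E)) = 2 * m) (hempty : PositivesExceed homog V ∅ m)
    (hj : j ≤ m) : PositivesExceed homog V (towerVertices x y j) (m - j) := by
  rcases Nat.eq_zero_or_pos j with rfl | hpos
  · simpa [towerVertices_zero] using hempty
  have hsub : towerVertices x y j ⊆ V := (towerVertices_mono hj).trans (by
    rw [← Finset.coe_subset, ← hV]
    exact hT.towerVertices_subset)
  have hcard := hT.card_towerVertices hj
  have hind := hempty.linearIndepOn hsub (by rw [Finset.sdiff_empty]; omega)
  have huniv := hT.universal j ⟨hpos, hj⟩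
  rw [towerFace_eq_convexHull, isUniversalFace_convexHull_iff hV hsub hind (by omega), hdim,
    show (2 * m - (2 * j - 1) - 1) / 2 = m - j by omega] at huniv
  exact (positivesExceed_iff hsub).2 ⟨hind, huniv⟩

end IsUniversalTower

lemma IsExactlyBeyond.exists_isSupporting [FiniteDimensional ℝ E]
    (hz : IsExactlyBeyond (convexHull ℝ (V : Set E)) (towerFacets (convexHull ℝ V) m x y) z)
    (hdim : affDim (convexHull ℝ (V : Set E)) = Module.finrank ℝ E)
    (hpos : 0 < affDim (convexHull ℝ (V : Set E))) (hA : A ⊆ V) (hface : IsConeFace homog V A)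
    (hj : j ≤ m) (hTA : towerVertices x y j ⊆ A) (hw : w ∈ V) (hwA : w ∉ A)
    (hwT : j < m → w ∈ towerVertices x y (j + 1)) :
    ∃ φ, IsSupporting homog V A φ ∧ 0 < (-1) ^ j * φ (homog z) := by
  have hspan : Submodule.span ℝ (homog '' (V : Set E)) = ⊤ :=
    span_homog_image_eq_top ⟨w, hw⟩ (by rw [← affDim_convexHull, hdim])
  obtain ⟨φ, hφ, hφw, hker⟩ := hface.exists_isSupporting_ker_le_span hA hspan hw hwA
  have hVP : (V : Set E) ⊆ convexHull ℝ (V : Set E) := subset_convexHull ℝ _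
  have hnn := apply_homog_nonneg_of_mem_convexHull (s := V) (φ := φ) hφ.1
  have hker' := hker.trans (Submodule.span_mono (t := homog '' zeroFace (convexHull ℝ V) φ)
    (Set.image_mono fun v hv ↦ ⟨hVP hv.1, hv.2⟩))
  have hF := isFacet_zeroFace hnn (by rintro rfl; simp at hφw) hdim hpos hker'
  have haff := mem_affineSpan_zeroFace_iff hker'
  have hodd : zeroFace (convexHull ℝ V) φ ∈ towerFacets (convexHull ℝ V) m x y ↔ Odd j := by
    refine mem_towerFacets_iff hF hj ?_ fun hjm hsub ↦ hφw.ne' ?_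
    · rw [towerFace_eq_convexHull]
      exact convexHull_min (fun v hv ↦ ⟨hVP (hA (hTA hv)), hφ.2 v (hTA hv)⟩)
        (hF.2.1.convex (convex_convexHull ℝ _))
    · rw [towerFace_eq_convexHull] at hsub
      exact (hsub (subset_convexHull ℝ _ (hwT hjm))).2
  refine ⟨φ, hφ, ?_⟩
  rcases Nat.even_or_odd j with heven | hj_odd
  · rw [heven.neg_one_pow, one_mul, ← isBeneath_iff haff hnn (hVP hw) hφw]
    exact hz.2 _ hF (mt hodd.1 (Nat.not_odd_iff_even.2 heven))
  · rw [hj_odd.neg_one_pow, neg_one_mul, neg_pos, ← isBeyond_iff haff hnn (hVP hw) hφw]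
    exact hz.1 _ (hodd.2 hj_odd)

lemma isSewing_homog (hm : 0 < m) (hE : Module.finrank ℝ E = 2 * m)
    (hP : IsNeighbourly (convexHull ℝ (V : Set E)))
    (hdim : affDim (convexHull ℝ (V : Set E)) = 2 * m)
    (hV : vertices (convexHull ℝ (V : Set E)) = V) (hcard : 2 * m + 1 < V.card)
    (hT : IsUniversalTower (convexHull ℝ (V : Set E)) m x y)
    (hz : IsExactlyBeyond (convexHull ℝ (V : Set E)) (towerFacets (convexHull ℝ V) m x y) z) :
    IsSewing homog V z m x y := by
  have : FiniteDimensional ℝ E := Module.finite_of_finrank_pos (by omega)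
  have hempty : PositivesExceed homog V ∅ m := by
    simpa [hdim] using hP.positivesExceed_empty hV (by omega)
  exact {
    pos := hm
    finrank_eq := by rw [Module.finrank_prod, hE, Module.finrank_self]
    lt_card := hcard
    tower_subset := by
      rw [← Finset.coe_subset, ← hV]
      exact hT.towerVertices_subset
    card_tower _ hj := hT.card_towerVertices hj
    positivesExceed_tower _ hj := hT.positivesExceed hV hdim hempty hj
    exists_isSupporting _ hj _ hA hface hTA _ hw hwA hwT :=
      hz.exists_isSupporting (hdim.trans hE.symm) (by omega) hA hface hj hTA hw hwA hwT }

end Tower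

section Sewing

variable {E : Type*} [NormedAddCommGroup E] [NormedSpace ℝ E]
  {P U s : Set E} {V A : Finset E} {z : E} {x y : ℕ → E} {m i k d n : ℕ}

lemma sewn_convexHull : sewn (convexHull ℝ s) z = convexHull ℝ (insert z s) := by
  rw [sewn, Set.insert_eq, convexHull_convexHull_union_right, ← Set.insert_eq]

lemma affDim_sewn [FiniteDimensional ℝ E] (hdim : affDim P = Module.finrank ℝ E) :
    affDim (sewn P z) = Module.finrank ℝ E :=
  (Submodule.finrank_le _).antisymm (hdim ▸ Submodule.finrank_mono
    (vectorSpan_mono ℝ ((Set.subset_insert z P).trans (subset_convexHull ℝ _))))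

lemma IsFaceOfDim.exists_eq_convexHull [FiniteDimensional ℝ E]
    (hU : IsFaceOfDim (convexHull ℝ (V : Set E)) d U)
    (hind : ∀ Y ⊆ V, Y.card ≤ n → LinearIndepOn ℝ homog (Y : Set E)) (hdn : d + 1 < n) :
    ∃ A ⊆ V, A.card = d + 1 ∧ U = convexHull ℝ (A : Set E) := by
  classical
  obtain ⟨hne, hface, hdim⟩ := hU
  have hA : ((V.filter (· ∈ U) : Finset E) : Set E) = ↑V ∩ U := by
    ext v
    simp
  have hUA := hface.convexHull_inter_eq V.finite_toSet
  rw [← hA] at hUA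
  refine ⟨V.filter (· ∈ U), Finset.filter_subset _ _, ?_, hUA.symm⟩
  have hrank := finrank_span_homog_image (s := ((V.filter (· ∈ U) : Finset E) : Set E))
    (by rwa [← convexHull_nonempty_iff (𝕜 := ℝ), hUA])
  rw [← affDim_convexHull, hUA, hdim] at hrank
  rw [← hrank]
  exact card_eq_finrank_span_image (fun Y hY ↦ hind Y (hY.trans (Finset.filter_subset _ _)))
    (hrank.trans_lt hdn)

namespace IsSewing

variable [DecidableEq E]

lemma tower_subset_of_towerFace_subset (hS : IsSewing homog V z m x y)
    (hV : vertices (convexHull ℝ (V : Set E)) = V) (hAV : A ⊆ V) (hi : i ≤ m)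
    (hΦA : towerFace x y i ⊆ convexHull ℝ (A : Set E)) : towerVertices x y i ⊆ A := by
  intro v hv
  have hvV : v ∈ vertices (convexHull ℝ (V : Set E)) := by
    rw [hV]
    exact hS.tower_subset (towerVertices_mono hi hv)
  rw [← mem_convexHull_iff_of_subset_vertices (by rwa [hV, Finset.coe_subset])
    (convex_convexHull ℝ _) hvV]
  rw [towerFace_eq_convexHull] at hΦA
  exact hΦA (subset_convexHull ℝ _ hv)

lemma card_insert_insert (hS : IsSewing homog V z m x y) (hi : i < m) (hAV : A ⊆ V)
    (hxA : x (i + 1) ∉ A) : (insert z (insert (x (i + 1)) A)).card = A.card + 2 := by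
  rw [Finset.card_insert_of_notMem, Finset.card_insert_of_notMem hxA]
  exact fun hz ↦ hS.notMem (Finset.insert_subset (hS.x_mem hi) hAV hz)

lemma isUniversalFace_sewn_iff [FiniteDimensional ℝ E] (hS : IsSewing homog V z m x y)
    (hV : vertices (convexHull ℝ (V : Set E)) = V) (hE : Module.finrank ℝ E = 2 * m)
    (hdim : affDim (convexHull ℝ (V : Set E)) = 2 * m) (hi : i < m) (hk : 0 < k) (hkm : k < m)
    (hAV : A ⊆ V) (hcard : A.card = 2 * k) (hTA : towerVertices x y i ⊆ A) (hxA : x (i + 1) ∉ A)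
    (hA : IsUniversalFace (convexHull ℝ (V : Set E)) (2 * k - 1) (convexHull ℝ (A : Set E))) :
    IsUniversalFace (sewn (convexHull ℝ (V : Set E)) z) (2 * k - 1) (convexHull ℝ (A : Set E)) ↔
      Even i ∧ IsUniversalFace (sewn (convexHull ℝ (V : Set E)) z) (2 * k + 1)
        (convexHull ℝ (convexHull ℝ (A : Set E) ∪ {z, x (i + 1)})) := by
  have hsewn : sewn (convexHull ℝ (V : Set E)) z =
      convexHull ℝ ((insert z V : Finset E) : Set E) := by
    rw [sewn_convexHull, Finset.coe_insert]
  have hB : convexHull ℝ (convexHull ℝ (A : Set E) ∪ {z, x (i + 1)}) =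
      convexHull ℝ ((insert z (insert (x (i + 1)) A) : Finset E) : Set E) := by
    rw [convexHull_convexHull_union_left, Set.union_comm, Finset.coe_insert, Finset.coe_insert,
      Set.insert_union, Set.singleton_union]
  have hVz := vertices_convexHull_eq fun v hv ↦ hS.isConeFace_singleton (by omega) hv
  have hdimz := affDim_sewn (z := z) (hdim.trans hE.symm)
  have hAz : A ⊆ insert z V := hAV.trans (Finset.subset_insert z V)
  have hBz : insert z (insert (x (i + 1)) A) ⊆ insert z V :=
    Finset.insert_subset_insert z (Finset.insert_subset (hS.x_mem hi) hAV)
  have hAind := hS.linearIndepOn hAV (by omega)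
  have hBind := hS.linearIndepOn_insert hi hkm hAV hcard hTA
  have hBcard := hS.card_insert_insert hi hAV hxA
  have hA_codim : (2 * m - (2 * k - 1) - 1) / 2 = m - k := by omega
  have hB_codim : (2 * m - (2 * k + 1) - 1) / 2 = m - k - 1 := by omega
  rw [isUniversalFace_convexHull_iff hV hAV hAind (by omega), hdim, hA_codim] at hA
  rw [hsewn] at hdimz ⊢
  rw [hB, isUniversalFace_convexHull_iff hVz hAz hAind (by omega),
    isUniversalFace_convexHull_iff hVz hBz hBind (by omega), hdimz, hE, hA_codim, hB_codim]
  exact hS.isUniversalIn_sewn_iff hi hkm hAV hcard hTA hxA hA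

end IsSewing

end Sewing

end SewnPolytope

theorem theorem5p4_general {E : Type*} [NormedAddCommGroup E] [NormedSpace ℝ E] {m : ℕ}
    (hE : Module.finrank ℝ E = 2 * m) {P : Set E} (hP : SewnPolytope.IsNeighbourly P)
    (hdim : SewnPolytope.affDim P = 2 * m) (hcard : 2 * m + 2 ≤ (SewnPolytope.vertices P).ncard)
    {x y : ℕ → E} (hT : SewnPolytope.IsUniversalTower P m x y) {z : E}
    (hz : SewnPolytope.IsExactlyBeyond P (SewnPolytope.towerFacets P m x y) z) {i k : ℕ}
    (hk : 0 < k) (hkm : k < m) {U : Set E} (hU : SewnPolytope.IsUniversalFace P (2 * k - 1) U)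
    (hΦU : SewnPolytope.towerFace x y i ⊆ U) (hxU : x (i + 1) ∉ U) :
    SewnPolytope.IsUniversalFace (SewnPolytope.sewn P z) (2 * k - 1) U ↔
      Even i ∧ SewnPolytope.IsUniversalFace (SewnPolytope.sewn P z) (2 * k + 1)
        (convexHull ℝ (U ∪ {z, x (i + 1)})) := by
  classical
  have : FiniteDimensional ℝ E := Module.finite_of_finrank_pos (by omega)
  obtain ⟨V, rfl, hV⟩ := hP.1.exists_eq_convexHull
  rw [hV, Set.ncard_coe_finset] at hcard
  have hS := SewnPolytope.isSewing_homog (by omega) hE hP hdim hV hcard hT hz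
  obtain ⟨A, hAV, hAcard, rfl⟩ :=
    hU.1.exists_eq_convexHull (fun _ hY ↦ hS.linearIndepOn hY) (by omega)
  have hi : i < m := by
    by_contra! hmi
    have hmA := Finset.card_le_card (hS.tower_subset_of_towerFace_subset hV hAV le_rfl
      ((SewnPolytope.towerFace_mono hmi).trans hΦU))
    rw [hS.card_tower m le_rfl] at hmA
    omega
  exact hS.isUniversalFace_sewn_iff hV hE hdim hi hk hkm hAV (by omega)
    (hS.tower_subset_of_towerFace_subset hV hAV hi.le hΦU)
    (fun hx ↦ hxU (subset_convexHull ℝ _ hx)) hU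

theorem theorem5p4 (m : ℕ) (P : Set (EuclideanSpace ℝ (Fin (2 * m))))
    (hP : SewnPolytope.IsNeighbourly P)
    (hdim : SewnPolytope.affDim P = 2 * m)
    (hcard : 2 * m + 3 ≤ (SewnPolytope.vertices P).ncard)
    (x y : ℕ → EuclideanSpace ℝ (Fin (2 * m)))
    (hT : SewnPolytope.IsUniversalTower P m x y)
    (xbar : EuclideanSpace ℝ (Fin (2 * m)))
    (hxbar : SewnPolytope.IsExactlyBeyond P (SewnPolytope.towerFacets P m x y) xbar)
    (i k : ℕ) (hik : i < k) (hkm : k < m)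
    (U : Set (EuclideanSpace ℝ (Fin (2 * m))))
    (hU : SewnPolytope.IsUniversalFace P (2 * k - 1) U)
    (hΦU : SewnPolytope.towerFace x y i ⊆ U)
    (hxU : x (i + 1) ∉ U) :
    SewnPolytope.IsUniversalFace (SewnPolytope.sewn P xbar) (2 * k - 1) U ↔
      Even i ∧
        SewnPolytope.IsUniversalFace (SewnPolytope.sewn P xbar) (2 * k + 1)
          (convexHull ℝ (U ∪ {xbar, x (i + 1)})) := by
  exact theorem5p4_general finrank_euclideanSpace_fin hP hdim (by omega) hT hxbar (by omega) hkm hU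
    hΦU hxU
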